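/- Let $M\ge 1$, $\sigma_N^2>0$, $R>0$, and let $\mathbf h=(h_0,\dots,h_{M-1})$ with $h_m\ge 0$ for all $m$ and $h_m>0$ for at least one $m$. For block powers $P_m,J_m\ge 0$ of a transmitter and a jammer put $$I_M(\{P_m\},\{J_m\})=\frac1M\sum_{m=0}^{M-1}\log\Bigl(1+\frac{h_mP_m}{\sigma_N^2+J_m}\Bigr),\qquad P_M=\frac1M\sum_m P_m,\qquad J_M=\frac1M\sum_m J_m .$$ For $j\ge0$ and $p\ge 0$ define the required-power curves $$\mathscr P_M(j)=\sup_{J_m\ge0,\ J_M\le j}\ \inf\{P_M:\ P_m\ge0,\ I_M(\{P_m\},\{J_m\})\ge R\},$$ $$\mathscr J_M(p)=\sup_{P_m\ge0,\ P_M\le p}\ \inf\{J_M:\ J_m\ge0,\ I_M(\{P_m\},\{J_m\})\le R\}.$$ Let $P_{M,\mathbf h}>0$ and $J_{M,\mathbf h}>0$. Consider the two-player zero-sum game in which the transmitter chooses a probability distribution $F_P$ of a frame power $P_M\ge0$ with $\mathbf E P_M\le P_{M,\mathbf h}$, the jammer chooses a probability distribution $F_J$ of a frame power $J_M\ge0$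 with $\mathbf E J_M\le J_{M,\mathbf h}$, the variables $P_M$ and $J_M$ are independent, and the transmitter minimizes while the jammer maximizes the outage probability $P_{out,\mathbf h}$, where either $P_{out,\mathbf h}=1-\Pr\{P_M\ge\mathscr P_M(J_M)\}$ or $P_{out,\mathbf h}=\Pr\{J_M\ge\mathscr J_M(P_M)\}$ (the two differ only in the treatment of ties; the result holds, with the same parameters and strategies, for each). Then the game has exactly one Nash equilibrium $(F_P,F_J)$, and it is the following, with parameters $k_p,k_j\in[0,1]$ and $v\in[\max\{J_{M,\mathbf h},\mathscr J_M(P_{M,\mathbf h})/2\},\infty)$. $F_P$ is the law of a variable that equals $\mathscr P_M(Y)$, $Y$ uniform on $[0,2v]$, with probability $k_p$, and equals $0$ with probability $1-k_p$; $F_J$ is the law of a variable that equals $\mathscr J_M(X)$, $X$ uniform on $[0,\mathscr P_M(2v)]$, with probability $k_j$, and equals $0$ with probability $1-k_j$. In particular, writing $\mathbb U([0,t])$ and $\Delta_0$ for the CDFs of the uniform law on $[0,t]$ and of the Dirac mass at $0$, $$F_P(\mathscr P_M(y))=k_p\,\mathbb U([0,2v])(y)+(1-k_p)\Delta_0(y)\quad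 (y\ge0),$$ $$F_J(\mathscr J_M(x))=k_j\,\mathbb U([0,\mathscr P_M(2v)])(x)+(1-k_j)\Delta_0(x)\quad (x\ge\mathscr P_M(0)).$$ The parameters are determined as follows. 1. There is a unique $v_0\ge0$ with $P_{M,\mathbf h}J_{M,\mathbf h}=[\mathscr P_M(2v_0)-P_{M,\mathbf h}](2v_0-J_{M,\mathbf h})$. 2. Let $S=\int_0^{2v_0}\mathscr P_M(y)\,dy-2v_0P_{M,\mathbf h}$. 3. If $S<0$, then $v$ is the unique positive solution of $\int_0^{2v}\mathscr P_M(y)\,dy-2vP_{M,\mathbf h}=0$, $k_p=1$, and $k_j=\dfrac{J_{M,\mathbf h}\mathscr P_M(2v)}{2v[\mathscr P_M(2v)-P_{M,\mathbf h}]}$. 4. If $S=0$, then $v=v_0$ and $k_p=k_j=1$. 5. If $S>0$, then $v$ is the unique nonnegative solution of $\int_0^{2v}\mathscr P_M(y)\,dy-\mathscr P_M(2v)(2v-J_{M,\mathbf h})=0$, $k_p=\dfrac{2vP_{M,\mathbf h}}{\mathscr P_M(2v)[2v-J_{M,\mathbf h}]}$, and $k_j=1$. -/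

import Mathlib

open MeasureTheory ProbabilityTheory

noncomputable section

namespace JammingGame

/-- Average over the `M` blocks of a frame. -/
def frameAvg {M : ℕ} (x : Fin M → ℝ) : ℝ := (1 / (M : ℝ)) * ∑ m, x m

/-- Instantaneous mutual information `I_M` over a frame with squared channel gains `h`, noise
variance `σ2`, transmitter block powers `P` and jammer block powers `J`. -/
def mutualInfo {M : ℕ} (h : Fin M → ℝ) (σ2 : ℝ) (P J : Fin M → ℝ) : ℝ :=
  frameAvg fun m => Real.log (1 + h m * P m / (σ2 + J m))

/-- Inner minimum of Problem 1: the least frame power with which the transmitter achieves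
`I_M ≥ R` against the jammer's block powers `J`. -/
def minTxPower {M : ℕ} (h : Fin M → ℝ) (σ2 R : ℝ) (J : Fin M → ℝ) : ℝ :=
  sInf {p | ∃ P : Fin M → ℝ, (∀ m, 0 ≤ P m) ∧ R ≤ mutualInfo h σ2 P J ∧ p = frameAvg P}

/-- Value of Problem 1 as a function of the jammer's frame power `j`: the transmitter's required
frame power `𝒫_M(j)`. -/
def txCurve {M : ℕ} (h : Fin M → ℝ) (σ2 R : ℝ) (j : ℝ) : ℝ :=
  sSup {q | ∃ J : Fin M → ℝ, (∀ m, 0 ≤ J m) ∧ frameAvg J ≤ j ∧ q = minTxPower h σ2 R J}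

/-- Inner minimum of Problem 2: the least frame power with which the jammer achieves
`I_M ≤ R` against the transmitter's block powers `P`. -/
def minJxPower {M : ℕ} (h : Fin M → ℝ) (σ2 R : ℝ) (P : Fin M → ℝ) : ℝ :=
  sInf {j | ∃ J : Fin M → ℝ, (∀ m, 0 ≤ J m) ∧ mutualInfo h σ2 P J ≤ R ∧ j = frameAvg J}

/-- Value of Problem 2 as a function of the transmitter's frame power `p`: the jammer's required
frame power `𝒥_M(p)`. -/
def jxCurve {M : ℕ} (h : Fin M → ℝ) (σ2 R : ℝ) (p : ℝ) : ℝ :=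
  sSup {q | ∃ P : Fin M → ℝ, (∀ m, 0 ≤ P m) ∧ frameAvg P ≤ p ∧ q = minJxPower h σ2 R P}

/-- A mixed strategy with average power budget `c`: a probability distribution of a nonnegative
frame power whose mean is at most `c`. -/
structure IsMixedStrategy (c : ℝ) (μ : Measure ℝ) : Prop where
  isProb : IsProbabilityMeasure μ
  nonneg : ∀ᵐ x ∂μ, 0 ≤ x
  integrable : Integrable (fun x : ℝ => x) μ
  mean_le : ∫ x, x ∂μ ≤ c

/-- Outage probability `1 - Pr{P_M ≥ 𝒫_M(J_M)}`, for independent `P_M ∼ μ` and `J_M ∼ ν`. -/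
def outageProb {M : ℕ} (h : Fin M → ℝ) (σ2 R : ℝ) (μ ν : Measure ℝ) : ℝ :=
  1 - (μ.prod ν).real {z : ℝ × ℝ | txCurve h σ2 R z.2 ≤ z.1}

/-- Outage probability `Pr{J_M ≥ 𝒥_M(P_M)}`, for independent `P_M ∼ μ` and `J_M ∼ ν`. It differs
from `outageProb` only in that the tie `P_M = 𝒫_M(J_M)` counts as an outage. -/
def outageProb' {M : ℕ} (h : Fin M → ℝ) (σ2 R : ℝ) (μ ν : Measure ℝ) : ℝ :=
  (μ.prod ν).real {z : ℝ × ℝ | jxCurve h σ2 R z.1 ≤ z.2}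

/-- Nash equilibrium of the zero-sum game with payoff `K`: the first player minimizes with mean
budget `a`, the second one maximizes with mean budget `b`. -/
structure IsNash (K : Measure ℝ → Measure ℝ → ℝ) (a b : ℝ) (μ ν : Measure ℝ) : Prop where
  left : IsMixedStrategy a μ
  right : IsMixedStrategy b ν
  min_left : ∀ μ', IsMixedStrategy a μ' → K μ ν ≤ K μ' ν
  max_right : ∀ ν', IsMixedStrategy b ν' → K μ ν' ≤ K μ ν

/-- The uniform distribution on `[0, t]` (for `0 < t`). -/
def unif (t : ℝ) : Measure ℝ := cond volume (Set.Icc 0 t)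

/-- The law that is `f(U)`, with `U` uniform on `[0, t]`, with probability `k` and `0` with
probability `1 - k`. -/
def mixLaw (k t : ℝ) (f : ℝ → ℝ) : Measure ℝ :=
  ENNReal.ofReal k • (unif t).map f + ENNReal.ofReal (1 - k) • Measure.dirac 0

end JammingGame

end

open MeasureTheory ProbabilityTheory

noncomputable section

namespace JammingGame

/-! ### Frame averages and the compact convex sets of block powers -/

section Frame

variable {M : ℕ}

/-! Write `g` and `q` for the transmitter's and the jammer's required-power curve. The channel
enters only through `IsCurvePair`: on `[0, ∞)`, `g` is positive, continuous, strictly increasing,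
unbounded and satisfies `t * g j ≤ g (t * j)` for `t ≤ 1`, while `q` inverts `g` and vanishes up to
`g 0`. The properties of `g` follow from one scaling estimate, `mul_minTxPower_le`. That `q` inverts
`g` is a minimax statement: the rate is concave in the transmitter's powers and convex in the
jammer's, so Sion's theorem gives a saddle point (`exists_saddle_mutualInfo`, used in
`le_jxCurve_of_lt`).

With `w = 2 * v`, the candidate laws make the opponent's payoff linear. Against the transmitter's
law, a jammer at `j` causes outage with probability at most `(1 - kp) + kp * min (j / w) 1`; against
the jammer's law, a transmitter at `p` suffers outage with probability at least `kj * (1 - min (p /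
g w) 1)`. The mean constraints bound the expectations (`payoff_txLaw_le`, `le_payoff_jxLaw`). The
two bounds coincide (`value_eq`) when both laws exhaust their budgets and at least one of them has
no atom at `0`. `exists_equilibriumParam` solves these conditions; the sign of `S` decides which
weight is `1`.

For uniqueness (`eq_txLaw_of_optimal`, `eq_jxLaw_of_optimal`), an optimal strategy is tested against
two-point laws, which puts its outage function on one side of a line. Integrating against the
opponent's equilibrium law forces equality almost everywhere, hence on a dense part of the support.
Monotonicity and one-sided limits remove the ambiguity of ties, so the distribution function is
known along the curve. Below `g 0` the curve says nothing about the transmitter; there the mean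
budget sends all remaining mass to `0` (`eq_real_Iic_eq_of_integral_le` in the form
`eq_of_real_Iic_eq_of_integral_le`). -/

lemma frameAvg_mono {x y : Fin M → ℝ} (h : ∀ m, x m ≤ y m) : frameAvg x ≤ frameAvg y :=
  mul_le_mul_of_nonneg_left (Finset.sum_le_sum fun m _ => h m) (by positivity)

lemma frameAvg_strictMono {x y : Fin M → ℝ} (h : ∀ m, x m ≤ y m) (h' : ∃ m, x m < y m) :
    frameAvg x < frameAvg y := by
  obtain ⟨m, hm⟩ := h'
  have : (0 : ℝ) < M := by exact_mod_cast m.pos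
  exact mul_lt_mul_of_pos_left
    (Finset.sum_lt_sum (fun m _ => h m) ⟨m, Finset.mem_univ m, hm⟩) (by positivity)

lemma frameAvg_nonneg {x : Fin M → ℝ} (h : ∀ m, 0 ≤ x m) : 0 ≤ frameAvg x :=
  mul_nonneg (by positivity) (Finset.sum_nonneg fun m _ => h m)

lemma frameAvg_smul (c : ℝ) (x : Fin M → ℝ) : (frameAvg fun m => c * x m) = c * frameAvg x := by
  simp only [frameAvg, ← Finset.mul_sum]; ring

lemma frameAvg_add (x y : Fin M → ℝ) :
    (frameAvg fun m => x m + y m) = frameAvg x + frameAvg y := by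
  simp only [frameAvg, Finset.sum_add_distrib]; ring

lemma frameAvg_const (hM : 0 < M) (c : ℝ) : (frameAvg fun _ : Fin M => c) = c := by
  have : (0 : ℝ) < M := by exact_mod_cast hM
  simp only [frameAvg, Finset.sum_const, Finset.card_univ, Fintype.card_fin, nsmul_eq_mul]
  field_simp

lemma le_mul_frameAvg {x : Fin M → ℝ} (h : ∀ m, 0 ≤ x m) (m : Fin M) :
    x m ≤ M * frameAvg x := by
  have : (0 : ℝ) < M := by exact_mod_cast m.pos
  have h2 := Finset.single_le_sum (fun i _ => h i) (Finset.mem_univ m)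
  simp only [frameAvg]
  rwa [← mul_assoc, mul_one_div_cancel this.ne', one_mul]

lemma continuous_frameAvg : Continuous (frameAvg : (Fin M → ℝ) → ℝ) := by
  unfold frameAvg; fun_prop

/-- The block powers within a frame power budget `c`. -/
def powerSet (M : ℕ) (c : ℝ) : Set (Fin M → ℝ) := {x | (∀ m, 0 ≤ x m) ∧ frameAvg x ≤ c}

lemma convex_powerSet (c : ℝ) : Convex ℝ (powerSet M c) := by
  rintro x ⟨hx, hx'⟩ y ⟨hy, hy'⟩ s t hs ht hst
  refine ⟨fun m => ?_, ?_⟩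
  · have := hx m; have := hy m
    simp only [Pi.add_apply, Pi.smul_apply, smul_eq_mul]; positivity
  · have e : frameAvg (s • x + t • y) = s * frameAvg x + t * frameAvg y := by
      rw [← frameAvg_smul, ← frameAvg_smul, ← frameAvg_add]; rfl
    rw [e]
    calc s * frameAvg x + t * frameAvg y ≤ s * c + t * c := by gcongr
      _ = c := by rw [← add_mul, hst, one_mul]

lemma isCompact_powerSet (c : ℝ) : IsCompact (powerSet M c) := by
  refine IsCompact.of_isClosed_subset (isCompact_Icc (a := (0 : Fin M → ℝ))
    (b := fun _ => M * c)) ?_ ?_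
  · have : powerSet M c = (⋂ m, {x | 0 ≤ x m}) ∩ {x | frameAvg x ≤ c} := by
      ext x; simp [powerSet]
    rw [this]
    exact (isClosed_iInter fun m => isClosed_le continuous_const (continuous_apply m)).inter
      (isClosed_le continuous_frameAvg continuous_const)
  · rintro x ⟨hx, hx'⟩
    exact ⟨hx, fun m => (le_mul_frameAvg hx m).trans
      (mul_le_mul_of_nonneg_left hx' (Nat.cast_nonneg M))⟩

lemma zero_mem_powerSet {c : ℝ} (hc : 0 ≤ c) : (0 : Fin M → ℝ) ∈ powerSet M c :=
  ⟨fun _ => le_rfl, by simpa [frameAvg] using hc⟩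

end Frame

/-! ### Convexity and concavity of the rate; saddle point of the block-power game -/

lemma convexOn_log_one_add_div {s c : ℝ} (hs : 0 < s) (hc : 0 ≤ c) :
    ConvexOn ℝ (Set.Ici 0) fun x : ℝ => Real.log (1 + c / (s + x)) := by
  have hd : ∀ x : ℝ, 0 ≤ x → HasDerivAt (fun x : ℝ => Real.log (1 + c / (s + x)))
      (-(c / ((s + x) * (s + x + c)))) x := by
    intro x hx
    have h1 : HasDerivAt (fun x : ℝ => s + x) 1 x := (hasDerivAt_id x).const_add s
    have hsx : 0 < s + x := by positivity
    have h2 : HasDerivAt (fun x : ℝ => 1 + c / (s + x)) (-c / (s + x) ^ 2) x := by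
      have := ((hasDerivAt_const x c).fun_div h1 hsx.ne').const_add 1
      simpa using this
    have h3 : 0 < 1 + c / (s + x) := by positivity
    convert h2.log h3.ne' using 1
    field_simp
  refine MonotoneOn.convexOn_of_deriv (convex_Ici 0)
    (fun x hx => (hd x hx).continuousAt.continuousWithinAt) ?_ ?_
  · intro x hx
    rw [interior_Ici] at hx
    exact (hd x (le_of_lt hx)).differentiableAt.differentiableWithinAt
  · rw [interior_Ici]
    intro x hx y hy hxy
    rw [Set.mem_Ioi] at hx hy
    rw [(hd x hx.le).deriv, (hd y hy.le).deriv]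
    gcongr

lemma concaveOn_log_one_add_mul {c s : ℝ} (hs : 0 < s) (hc : 0 ≤ c) :
    ConcaveOn ℝ (Set.Ici 0) fun x : ℝ => Real.log (1 + c * x / s) := by
  refine ⟨convex_Ici 0, fun x hx y hy α β hα hβ hαβ => ?_⟩
  rw [Set.mem_Ici] at hx hy
  have := strictConcaveOn_log_Ioi.concaveOn.2 (x := 1 + c * x / s) (y := 1 + c * y / s)
    (by rw [Set.mem_Ioi]; positivity) (by rw [Set.mem_Ioi]; positivity) hα hβ hαβ
  refine this.trans (le_of_eq ?_)
  congr 1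
  simp only [smul_eq_mul]
  field_simp
  linear_combination s * hαβ

section Channel

variable {M : ℕ} {h : Fin M → ℝ} {σ2 R : ℝ}

lemma sinr_nonneg (hh : ∀ m, 0 ≤ h m) (hσ : 0 < σ2) {P J : Fin M → ℝ} (hP : ∀ m, 0 ≤ P m)
    (hJ : ∀ m, 0 ≤ J m) (m : Fin M) : 0 ≤ h m * P m / (σ2 + J m) := by
  have := hh m; have := hP m; have := hJ m
  positivity

lemma mutualInfo_mono (hh : ∀ m, 0 ≤ h m) (hσ : 0 < σ2) {P J P' J' : Fin M → ℝ}
    (hP : ∀ m, 0 ≤ P m) (hJ : ∀ m, 0 ≤ J m)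
    (hle : ∀ m, h m * P m / (σ2 + J m) ≤ h m * P' m / (σ2 + J' m)) :
    mutualInfo h σ2 P J ≤ mutualInfo h σ2 P' J' := by
  refine frameAvg_mono fun m => Real.log_le_log ?_ (by linarith [hle m])
  linarith [sinr_nonneg hh hσ hP hJ m]

lemma convexOn_mutualInfo (hh : ∀ m, 0 ≤ h m) (hσ : 0 < σ2) {P : Fin M → ℝ} (hP : ∀ m, 0 ≤ P m)
    (c : ℝ) : ConvexOn ℝ (powerSet M c) fun J => mutualInfo h σ2 P J := by
  refine ⟨convex_powerSet c, fun x hx y hy s t hs ht hst => ?_⟩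
  simp only [smul_eq_mul, mutualInfo]
  rw [← frameAvg_smul, ← frameAvg_smul, ← frameAvg_add]
  exact frameAvg_mono fun m =>
    (convexOn_log_one_add_div hσ (mul_nonneg (hh m) (hP m))).2 (hx.1 m) (hy.1 m) hs ht hst

lemma concaveOn_mutualInfo (hh : ∀ m, 0 ≤ h m) (hσ : 0 < σ2) {J : Fin M → ℝ} (hJ : ∀ m, 0 ≤ J m)
    (c : ℝ) : ConcaveOn ℝ (powerSet M c) fun P => mutualInfo h σ2 P J := by
  refine ⟨convex_powerSet c, fun x hx y hy s t hs ht hst => ?_⟩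
  simp only [smul_eq_mul, mutualInfo]
  rw [← frameAvg_smul, ← frameAvg_smul, ← frameAvg_add]
  exact frameAvg_mono fun m =>
    (concaveOn_log_one_add_mul (add_pos_of_pos_of_nonneg hσ (hJ m)) (hh m)).2
      (hx.1 m) (hy.1 m) hs ht hst

lemma continuousOn_mutualInfo_right (hh : ∀ m, 0 ≤ h m) (hσ : 0 < σ2) {P : Fin M → ℝ}
    (hP : ∀ m, 0 ≤ P m) (c : ℝ) : ContinuousOn (fun J => mutualInfo h σ2 P J) (powerSet M c) := by
  refine continuous_frameAvg.comp_continuousOn (continuousOn_pi.2 fun m => ?_)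
  refine ContinuousOn.log ?_ fun J hJ => ?_
  · refine continuousOn_const.add (continuousOn_const.div (by fun_prop) fun J hJ => ?_)
    linarith [hJ.1 m]
  · linarith [sinr_nonneg hh hσ hP hJ.1 m]

lemma continuousOn_mutualInfo_left (hh : ∀ m, 0 ≤ h m) (hσ : 0 < σ2) {J : Fin M → ℝ}
    (hJ : ∀ m, 0 ≤ J m) (c : ℝ) : ContinuousOn (fun P => mutualInfo h σ2 P J) (powerSet M c) := by
  refine continuous_frameAvg.comp_continuousOn (continuousOn_pi.2 fun m => ?_)
  refine ContinuousOn.log (by fun_prop) fun P hP => ?_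
  linarith [sinr_nonneg hh hσ hP.1 hJ m]

/-- The block-power game with payoff `I_M` has a saddle point. -/
lemma exists_saddle_mutualInfo (hh : ∀ m, 0 ≤ h m) (hσ : 0 < σ2) {p j : ℝ} (hp : 0 ≤ p)
    (hj : 0 ≤ j) : ∃ J₀ ∈ powerSet M j, ∃ P₀ ∈ powerSet M p, ∀ J ∈ powerSet M j,
      ∀ P ∈ powerSet M p, mutualInfo h σ2 P J₀ ≤ mutualInfo h σ2 P₀ J :=
  Sion.exists_isSaddlePointOn (X := powerSet M j) (Y := powerSet M p)
    (f := fun J P => mutualInfo h σ2 P J) ⟨0, zero_mem_powerSet hj⟩ (convex_powerSet j)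
    (isCompact_powerSet j)
    (fun _ hP => (continuousOn_mutualInfo_right hh hσ hP.1 j).lowerSemicontinuousOn)
    (fun _ hP => (convexOn_mutualInfo hh hσ hP.1 j).quasiconvexOn) (convex_powerSet p)
    ⟨0, zero_mem_powerSet hp⟩ (isCompact_powerSet p)
    (fun _ hJ => (continuousOn_mutualInfo_left hh hσ hJ.1 p).upperSemicontinuousOn)
    (fun _ hJ => (concaveOn_mutualInfo hh hσ hJ.1 p).quasiconcaveOn)

end Channel

lemma continuousWithinAt_of_abs_sub_le {f : ℝ → ℝ} {s : Set ℝ} {x C : ℝ}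
    (H : ∀ y ∈ s, |f y - f x| ≤ C * |y - x|) : ContinuousWithinAt f s x := by
  rw [ContinuousWithinAt, tendsto_iff_dist_tendsto_zero]
  have h0 : Filter.Tendsto (fun y => C * |y - x|) (nhdsWithin x s) (nhds 0) := by
    have : Continuous fun y => C * |y - x| := by fun_prop
    have h := (this.tendsto x).mono_left (nhdsWithin_le_nhds (s := s))
    simpa using h
  refine squeeze_zero' (Filter.Eventually.of_forall fun _ => dist_nonneg) ?_ h0
  filter_upwards [self_mem_nhdsWithin] with y hy
  rw [Real.dist_eq]
  exact H y hy

/-! ### Required transmitter power against fixed interference -/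

section MinTx

variable {M : ℕ} {h : Fin M → ℝ} {σ2 R : ℝ}

lemma exists_le_mutualInfo (hh : ∀ m, 0 ≤ h m) (hpos : ∃ m, 0 < h m) (hσ : 0 < σ2)
    {J : Fin M → ℝ} (hJ : ∀ m, 0 ≤ J m) :
    ∃ P : Fin M → ℝ, (∀ m, 0 ≤ P m) ∧ R ≤ mutualInfo h σ2 P J := by
  obtain ⟨m, hm⟩ := hpos
  have hM : (0 : ℝ) < M := by exact_mod_cast m.pos
  have hs : 0 < σ2 + J m := add_pos_of_pos_of_nonneg hσ (hJ m)
  have hP : 0 ≤ Real.exp (M * |R|) - 1 := by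
    have := Real.add_one_le_exp (M * |R|)
    have : 0 ≤ M * |R| := by positivity
    linarith
  -- This power gives block `m` the rate `M * |R|`, so that block alone lifts the frame average to
  -- `|R|`.
  set x : ℝ := (Real.exp (M * |R|) - 1) * (σ2 + J m) / h m with hx
  have hx0 : 0 ≤ x := by positivity
  refine ⟨fun _ => x, fun _ => hx0, ?_⟩
  have h1 := Finset.single_le_sum (f := fun i => Real.log (1 + h i * x / (σ2 + J i)))
    (fun i _ => Real.log_nonneg (by
      have := sinr_nonneg hh hσ (fun _ => hx0) hJ i
      linarith)) (Finset.mem_univ m)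
  have h2 : h m * x / (σ2 + J m) = Real.exp (M * |R|) - 1 := by
    rw [hx]; field_simp
  rw [h2, add_sub_cancel, Real.log_exp] at h1
  calc R ≤ |R| := le_abs_self R
    _ = 1 / M * (M * |R|) := by field_simp
    _ ≤ _ := mul_le_mul_of_nonneg_left h1 (by positivity)

lemma minTxPower_le {P J : Fin M → ℝ} (hP : ∀ m, 0 ≤ P m) (hI : R ≤ mutualInfo h σ2 P J) :
    minTxPower h σ2 R J ≤ frameAvg P :=
  csInf_le ⟨0, by rintro _ ⟨P, hP, _, rfl⟩; exact frameAvg_nonneg hP⟩ ⟨P, hP, hI, rfl⟩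

lemma le_minTxPower (hh : ∀ m, 0 ≤ h m) (hpos : ∃ m, 0 < h m) (hσ : 0 < σ2)
    {J : Fin M → ℝ} (hJ : ∀ m, 0 ≤ J m) {c : ℝ}
    (H : ∀ P : Fin M → ℝ, (∀ m, 0 ≤ P m) → R ≤ mutualInfo h σ2 P J → c ≤ frameAvg P) :
    c ≤ minTxPower h σ2 R J := by
  obtain ⟨P, hP, hI⟩ := exists_le_mutualInfo (R := R) hh hpos hσ hJ
  refine le_csInf ⟨_, P, hP, hI, rfl⟩ ?_
  rintro _ ⟨P, hP, hI, rfl⟩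
  exact H P hP hI

lemma exists_frameAvg_lt_of_minTxPower_lt (hh : ∀ m, 0 ≤ h m) (hpos : ∃ m, 0 < h m) (hσ : 0 < σ2)
    {J : Fin M → ℝ} (hJ : ∀ m, 0 ≤ J m) {p : ℝ} (hp : minTxPower h σ2 R J < p) :
    ∃ P : Fin M → ℝ, (∀ m, 0 ≤ P m) ∧ R ≤ mutualInfo h σ2 P J ∧ frameAvg P < p := by
  by_contra! H
  exact hp.not_ge (le_minTxPower hh hpos hσ hJ H)

/-- Scaling up noise plus interference by a factor `c` in each block scales up the required
transmitter power by at least the same factor. -/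
lemma mul_minTxPower_le (hh : ∀ m, 0 ≤ h m) (hpos : ∃ m, 0 < h m) (hσ : 0 < σ2)
    {J J' : Fin M → ℝ} (hJ : ∀ m, 0 ≤ J m) (hJ' : ∀ m, 0 ≤ J' m) {c : ℝ} (hc : 0 < c)
    (hle : ∀ m, c * (σ2 + J m) ≤ σ2 + J' m) :
    c * minTxPower h σ2 R J ≤ minTxPower h σ2 R J' := by
  refine le_minTxPower hh hpos hσ hJ' fun P hP hI => ?_
  have hP' : ∀ m, 0 ≤ c⁻¹ * P m := fun m => mul_nonneg (inv_nonneg.2 hc.le) (hP m)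
  have hI' : R ≤ mutualInfo h σ2 (fun m => c⁻¹ * P m) J := by
    refine hI.trans (mutualInfo_mono hh hσ hP hJ' fun m => ?_)
    have h1 : 0 < σ2 + J m := add_pos_of_pos_of_nonneg hσ (hJ m)
    have h2 : h m * (c⁻¹ * P m) / (σ2 + J m) = h m * P m / (c * (σ2 + J m)) := by
      field_simp
    rw [h2]
    exact div_le_div_of_nonneg_left (mul_nonneg (hh m) (hP m)) (by positivity) (hle m)
  have := minTxPower_le hP' hI'
  rw [frameAvg_smul] at this
  calc c * minTxPower h σ2 R J ≤ c * (c⁻¹ * frameAvg P) := by gcongr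
    _ = frameAvg P := by field_simp

/-- Since `log (1 + x) ≤ x` and each gain is at most their sum, the rate is at most `(∑ m, h m) /
σ2` times the frame power. -/
lemma minTxPower_zero_pos (hh : ∀ m, 0 ≤ h m) (hpos : ∃ m, 0 < h m) (hσ : 0 < σ2) (hR : 0 < R) :
    0 < minTxPower h σ2 R 0 := by
  have hH : 0 < ∑ m, h m := by
    obtain ⟨m, hm⟩ := hpos
    exact Finset.sum_pos' (fun m _ => hh m) ⟨m, Finset.mem_univ m, hm⟩
  refine lt_of_lt_of_le (div_pos (mul_pos hR hσ) hH)
    (le_minTxPower hh hpos hσ (fun _ => le_rfl) fun P hP hI => ?_)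
  have h1 : mutualInfo h σ2 P 0 ≤ frameAvg fun m => (∑ m, h m) / σ2 * P m := by
    refine frameAvg_mono fun m => ?_
    have h0 := sinr_nonneg hh hσ hP (fun _ => le_rfl) (J := 0) m
    have h2 := Real.log_le_sub_one_of_pos (show 0 < 1 + h m * P m / (σ2 + (0 : Fin M → ℝ) m) by
      linarith)
    refine h2.trans ?_
    have := Finset.single_le_sum (fun i _ => hh i) (Finset.mem_univ m)
    have := hP m
    simp only [Pi.zero_apply, add_zero, add_sub_cancel_left]
    rw [div_mul_eq_mul_div]
    gcongr
  rw [frameAvg_smul] at h1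
  rw [div_le_iff₀ hH]
  have h2 := hI.trans h1
  rw [div_mul_eq_mul_div, le_div_iff₀ hσ] at h2
  linarith

end MinTx

/-! ### The required-power curves and their inversion -/

section Curves

variable {M : ℕ} {h : Fin M → ℝ} {σ2 R : ℝ}

/-- At worst a single block receives the whole frame's jamming power `M * j`, so no block's noise
grows by more than the factor `1 + M * j / σ2`. -/
lemma minTxPower_le_of_frameAvg_le (hh : ∀ m, 0 ≤ h m) (hpos : ∃ m, 0 < h m) (hσ : 0 < σ2)
    {J : Fin M → ℝ} (hJ : ∀ m, 0 ≤ J m) {j : ℝ} (hj : frameAvg J ≤ j) :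
    minTxPower h σ2 R J ≤ (1 + M * j / σ2) * minTxPower h σ2 R 0 := by
  have hj0 : 0 ≤ j := (frameAvg_nonneg hJ).trans hj
  have hc : 0 < 1 + M * j / σ2 := by positivity
  have := mul_minTxPower_le (R := R) hh hpos hσ hJ (J' := 0) (fun _ => le_rfl) (inv_pos.2 hc)
    fun m => by
      rw [inv_mul_le_iff₀ hc]
      have h1 := (le_mul_frameAvg hJ m).trans (mul_le_mul_of_nonneg_left hj (Nat.cast_nonneg M))
      have : (1 + M * j / σ2) * (σ2 + (0 : Fin M → ℝ) m) = σ2 + M * j := by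
        simp only [Pi.zero_apply]; field_simp; ring
      linarith
  rwa [inv_mul_le_iff₀ hc] at this

lemma minTxPower_le_txCurve (hh : ∀ m, 0 ≤ h m) (hpos : ∃ m, 0 < h m) (hσ : 0 < σ2)
    {J : Fin M → ℝ} (hJ : ∀ m, 0 ≤ J m) {j : ℝ} (hj : frameAvg J ≤ j) :
    minTxPower h σ2 R J ≤ txCurve h σ2 R j := by
  refine le_csSup ⟨(1 + M * j / σ2) * minTxPower h σ2 R 0, ?_⟩ ⟨J, hJ, hj, rfl⟩
  rintro _ ⟨J, hJ, hj, rfl⟩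
  exact minTxPower_le_of_frameAvg_le hh hpos hσ hJ hj

lemma txCurve_le {j c : ℝ} (hj : 0 ≤ j)
    (H : ∀ J : Fin M → ℝ, (∀ m, 0 ≤ J m) → frameAvg J ≤ j → minTxPower h σ2 R J ≤ c) :
    txCurve h σ2 R j ≤ c := by
  refine csSup_le ⟨_, 0, fun _ => le_rfl, (zero_mem_powerSet hj).2, rfl⟩ ?_
  rintro _ ⟨J, hJ, hj, rfl⟩
  exact H J hJ hj

/-- The supremum is over the empty set and takes the default value `0`; this keeps the curve
monotone on all of `ℝ`. -/
lemma txCurve_of_neg {j : ℝ} (hj : j < 0) : txCurve h σ2 R j = 0 := by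
  rw [txCurve]
  convert Real.sSup_empty
  ext q
  simp only [Set.mem_ofPred_eq, Set.mem_empty_iff_false, iff_false]
  rintro ⟨J, hJ, hj', -⟩
  linarith [frameAvg_nonneg hJ]

lemma txCurve_zero_pos (hh : ∀ m, 0 ≤ h m) (hpos : ∃ m, 0 < h m) (hσ : 0 < σ2) (hR : 0 < R) :
    0 < txCurve h σ2 R 0 :=
  (minTxPower_zero_pos hh hpos hσ hR).trans_le
    (minTxPower_le_txCurve hh hpos hσ (fun _ => le_rfl) (zero_mem_powerSet le_rfl).2)

/-- The additional power `j - i` is spread evenly over the blocks. As the noise in a block was at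
most `σ2 + M * i`, it grows at least by the stated factor everywhere. -/
lemma mul_txCurve_le (hh : ∀ m, 0 ≤ h m) (hpos : ∃ m, 0 < h m) (hσ : 0 < σ2) {i j : ℝ}
    (hi : 0 ≤ i) (hij : i ≤ j) :
    (1 + (j - i) / (σ2 + M * i)) * txCurve h σ2 R i ≤ txCurve h σ2 R j := by
  have hM : 0 < M := hpos.choose.pos
  have hji : 0 ≤ j - i := sub_nonneg.2 hij
  have hc : 0 < 1 + (j - i) / (σ2 + M * i) := by positivity
  rw [← le_div_iff₀' hc]
  refine txCurve_le hi fun J hJ hJi => ?_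
  rw [le_div_iff₀' hc]
  have hJ' : ∀ m, 0 ≤ J m + (j - i) := fun m => add_nonneg (hJ m) hji
  refine (mul_minTxPower_le hh hpos hσ hJ hJ' hc fun m => ?_).trans
    (minTxPower_le_txCurve hh hpos hσ hJ' ?_)
  · have h1 := (le_mul_frameAvg hJ m).trans (mul_le_mul_of_nonneg_left hJi (Nat.cast_nonneg M))
    have h2 : (j - i) / (σ2 + M * i) * (σ2 + J m) ≤ j - i := by
      rw [div_mul_eq_mul_div, div_le_iff₀ (by positivity)]
      gcongr
    linarith
  · rw [frameAvg_add, frameAvg_const hM]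
    linarith

lemma strictMonoOn_txCurve (hh : ∀ m, 0 ≤ h m) (hpos : ∃ m, 0 < h m) (hσ : 0 < σ2) (hR : 0 < R) :
    StrictMonoOn (txCurve h σ2 R) (Set.Ici 0) := by
  have h0 := txCurve_zero_pos hh hpos hσ hR
  intro i hi j hj hij
  rw [Set.mem_Ici] at hi hj
  have hi' : 0 < txCurve h σ2 R i := by
    refine h0.trans_le (le_trans ?_ (mul_txCurve_le hh hpos hσ le_rfl hi))
    refine le_mul_of_one_le_left h0.le ?_
    simp only [sub_zero, mul_zero, add_zero, le_add_iff_nonneg_right]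
    positivity
  refine lt_of_lt_of_le ?_ (mul_txCurve_le hh hpos hσ hi hij.le)
  refine lt_mul_of_one_lt_left hi' ?_
  have : 0 < j - i := sub_pos.2 hij
  rw [lt_add_iff_pos_right]
  positivity

lemma exists_lt_txCurve (hh : ∀ m, 0 ≤ h m) (hpos : ∃ m, 0 < h m) (hσ : 0 < σ2) (hR : 0 < R)
    (c : ℝ) : ∃ j, 0 ≤ j ∧ c < txCurve h σ2 R j := by
  have h0 := txCurve_zero_pos hh hpos hσ hR
  refine ⟨σ2 * (|c| / txCurve h σ2 R 0), by positivity, ?_⟩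
  refine lt_of_lt_of_le ?_ (mul_txCurve_le hh hpos hσ le_rfl (by positivity))
  have : (1 + (σ2 * (|c| / txCurve h σ2 R 0) - 0) / (σ2 + M * 0)) * txCurve h σ2 R 0
      = txCurve h σ2 R 0 + |c| := by
    rw [mul_zero, add_zero, sub_zero]; field_simp
  rw [this]
  linarith [le_abs_self c]

/-- Scaling the jamming by `t ≤ 1` leaves `σ2` untouched, so total noise shrinks by no more than the
factor `t`. This star-shapedness replaces concavity in the proof of continuity and in the bound `2 *
b ≤ w`. -/
lemma mul_txCurve_le_txCurve_mul (hh : ∀ m, 0 ≤ h m) (hpos : ∃ m, 0 < h m) (hσ : 0 < σ2)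
    (hR : 0 < R) {t j : ℝ} (ht : 0 ≤ t) (ht1 : t ≤ 1) (hj : 0 ≤ j) :
    t * txCurve h σ2 R j ≤ txCurve h σ2 R (t * j) := by
  rcases ht.eq_or_lt with rfl | ht
  · simpa using (txCurve_zero_pos hh hpos hσ hR).le
  rw [← le_div_iff₀' ht]
  refine txCurve_le hj fun J hJ hJi => ?_
  rw [le_div_iff₀' ht]
  have hJ' : ∀ m, 0 ≤ t * J m := fun m => mul_nonneg ht.le (hJ m)
  refine (mul_minTxPower_le hh hpos hσ hJ hJ' ht fun m => ?_).trans
    (minTxPower_le_txCurve hh hpos hσ hJ' ?_)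
  · have := mul_le_of_le_one_left hσ.le ht1
    linarith
  · rw [frameAvg_smul]
    gcongr

/-- Monotonicity bounds the increment on one side and star-shapedness on the other, with constant `g
x / x` at `x > 0`. At `0` that constant is unavailable and the linear growth bound takes over. -/
lemma continuousOn_txCurve (hh : ∀ m, 0 ≤ h m) (hpos : ∃ m, 0 < h m) (hσ : 0 < σ2) (hR : 0 < R) :
    ContinuousOn (txCurve h σ2 R) (Set.Ici 0) := by
  have hmono := (strictMonoOn_txCurve hh hpos hσ hR).monotoneOn
  have h0 := txCurve_zero_pos hh hpos hσ hR
  intro x hx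
  rw [Set.mem_Ici] at hx
  rcases hx.eq_or_lt with rfl | hx
  · refine continuousWithinAt_of_abs_sub_le (C := M / σ2 * txCurve h σ2 R 0) fun y hy => ?_
    rw [Set.mem_Ici] at hy
    have h1 := hmono (Set.mem_Ici.2 le_rfl) (Set.mem_Ici.2 hy) hy
    have h2 : txCurve h σ2 R y ≤ (1 + M * y / σ2) * txCurve h σ2 R 0 :=
      txCurve_le hy fun J hJ hj => (minTxPower_le_of_frameAvg_le hh hpos hσ hJ hj).trans
        (mul_le_mul_of_nonneg_left (minTxPower_le_txCurve hh hpos hσ (fun _ => le_rfl)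
          (zero_mem_powerSet le_rfl).2) (by positivity))
    rw [abs_of_nonneg (by linarith), sub_zero, abs_of_nonneg hy]
    have : (1 + M * y / σ2) * txCurve h σ2 R 0 =
      txCurve h σ2 R 0 + M / σ2 * txCurve h σ2 R 0 * y := by ring
    linarith
  · refine continuousWithinAt_of_abs_sub_le (C := txCurve h σ2 R x / x) fun y hy => ?_
    rw [Set.mem_Ici] at hy
    rcases le_total y x with hyx | hxy
    · have h1 := hmono (Set.mem_Ici.2 hy) (Set.mem_Ici.2 hx.le) hyx
      have h2 := mul_txCurve_le_txCurve_mul hh hpos hσ hR (t := y / x) (by positivity)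
        ((div_le_one hx).2 hyx) hx.le
      rw [div_mul_cancel₀ _ hx.ne'] at h2
      rw [abs_of_nonpos (by linarith), abs_of_nonpos (by linarith)]
      have : txCurve h σ2 R x / x * -(y - x) = txCurve h σ2 R x - y / x * txCurve h σ2 R x := by
        field_simp; ring
      linarith
    · have h1 := hmono (Set.mem_Ici.2 hx.le) (Set.mem_Ici.2 hy) hxy
      have hy' : 0 < y := hx.trans_le hxy
      have h2 := mul_txCurve_le_txCurve_mul hh hpos hσ hR (t := x / y) (by positivity)
        ((div_le_one hy').2 hxy) hy
      rw [div_mul_cancel₀ _ hy'.ne', div_mul_eq_mul_div, div_le_iff₀ hy'] at h2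
      rw [abs_of_nonneg (by linarith), abs_of_nonneg (by linarith), div_mul_eq_mul_div,
        le_div_iff₀ hx]
      linarith

lemma minJxPower_le {P J : Fin M → ℝ} (hJ : ∀ m, 0 ≤ J m) (hI : mutualInfo h σ2 P J ≤ R) :
    minJxPower h σ2 R P ≤ frameAvg J :=
  csInf_le ⟨0, by rintro _ ⟨J, hJ, _, rfl⟩; exact frameAvg_nonneg hJ⟩ ⟨J, hJ, hI, rfl⟩

lemma minJxPower_nonneg (P : Fin M → ℝ) : 0 ≤ minJxPower h σ2 R P :=
  Real.sInf_nonneg (by rintro _ ⟨J, hJ, _, rfl⟩; exact frameAvg_nonneg hJ)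

lemma exists_mutualInfo_lt {P : Fin M → ℝ} (hP : ∀ m, 0 ≤ P m) {j : ℝ} (hj : 0 ≤ j)
    (hlt : frameAvg P < txCurve h σ2 R j) :
    ∃ J : Fin M → ℝ, (∀ m, 0 ≤ J m) ∧ frameAvg J ≤ j ∧ mutualInfo h σ2 P J < R := by
  by_contra! H
  exact hlt.not_ge (txCurve_le hj fun J hJ hJj => minTxPower_le hP (H J hJ hJj))

lemma minJxPower_le_of_frameAvg_lt {P : Fin M → ℝ} (hP : ∀ m, 0 ≤ P m) {j : ℝ} (hj : 0 ≤ j)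
    (hlt : frameAvg P < txCurve h σ2 R j) : minJxPower h σ2 R P ≤ j := by
  obtain ⟨J, hJ, hJj, hI⟩ := exists_mutualInfo_lt hP hj hlt
  exact (minJxPower_le hJ hI.le).trans hJj

lemma jxCurve_nonneg (p : ℝ) : 0 ≤ jxCurve h σ2 R p :=
  Real.sSup_nonneg (by rintro _ ⟨P, _, _, rfl⟩; exact minJxPower_nonneg P)

lemma jxCurve_le_of_lt {p j : ℝ} (hj : 0 ≤ j) (hp : p < txCurve h σ2 R j) :
    jxCurve h σ2 R p ≤ j := by
  refine Real.sSup_le ?_ hj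
  rintro _ ⟨P, hP, hPp, rfl⟩
  exact minJxPower_le_of_frameAvg_lt hP hj (hPp.trans_lt hp)

lemma jxCurve_le (hh : ∀ m, 0 ≤ h m) (hpos : ∃ m, 0 < h m) (hσ : 0 < σ2) (hR : 0 < R) {p j : ℝ}
    (hj : 0 ≤ j) (hp : p ≤ txCurve h σ2 R j) : jxCurve h σ2 R p ≤ j := by
  -- A slightly larger jamming power makes the inequality strict, so that no infimum or supremum has
  -- to be attained.
  refine le_of_forall_gt_imp_ge_of_dense fun i hi => ?_
  have hi0 : 0 ≤ i := hj.trans hi.le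
  exact jxCurve_le_of_lt hi0 (hp.trans_lt (strictMonoOn_txCurve hh hpos hσ hR hj hi0 hi))

lemma mutualInfo_add_const_lt (hh : ∀ m, 0 ≤ h m) (hσ : 0 < σ2) {P J : Fin M → ℝ}
    (hP : ∀ m, 0 ≤ P m) (hJ : ∀ m, 0 ≤ J m) {c : ℝ} (hc : 0 < c)
    (hI : 0 < mutualInfo h σ2 P J) :
    mutualInfo h σ2 P (fun m => J m + c) < mutualInfo h σ2 P J := by
  obtain ⟨m, hm⟩ : ∃ m, 0 < h m * P m := by
    by_contra! H
    refine hI.not_ge ?_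
    have : ∀ m, h m * P m = 0 := fun m => (H m).antisymm (mul_nonneg (hh m) (hP m))
    simp [mutualInfo, frameAvg, this]
  have hpos : ∀ m, 0 < σ2 + J m := fun m => add_pos_of_pos_of_nonneg hσ (hJ m)
  have hJc : ∀ m, 0 ≤ J m + c := fun m => add_nonneg (hJ m) hc.le
  refine frameAvg_strictMono (fun m => Real.log_le_log ?_ ?_) ⟨m, Real.log_lt_log ?_ ?_⟩
  · linarith [sinr_nonneg hh hσ hP hJc m]
  · have := div_le_div_of_nonneg_left (mul_nonneg (hh m) (hP m)) (hpos m)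
      (show σ2 + J m ≤ σ2 + (J m + c) by linarith)
    linarith
  · linarith [sinr_nonneg hh hσ hP hJc m]
  · have := div_lt_div_of_pos_left hm (hpos m) (show σ2 + J m < σ2 + (J m + c) by linarith)
    linarith

/-- Power `p` beats each single interference pattern within budget `j`; the saddle point yields one
allocation `P₀` that beats them all simultaneously, and `P₀` witnesses the supremum. -/
lemma le_jxCurve_of_lt (hh : ∀ m, 0 ≤ h m) (hpos : ∃ m, 0 < h m) (hσ : 0 < σ2) (hR : 0 < R)
    {p j : ℝ} (hj : 0 ≤ j) (hp : txCurve h σ2 R j < p) : j ≤ jxCurve h σ2 R p := by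
  have hM : 0 < M := hpos.choose.pos
  have hp0 : 0 ≤ p := ((txCurve_zero_pos hh hpos hσ hR).le.trans
    ((strictMonoOn_txCurve hh hpos hσ hR).monotoneOn (Set.mem_Ici.2 le_rfl) hj hj)).trans hp.le
  obtain ⟨J₀, hJ₀, P₀, hP₀, hsad⟩ := exists_saddle_mutualInfo hh hσ hp0 hj
  obtain ⟨P, hP, hPI, hPp⟩ := exists_frameAvg_lt_of_minTxPower_lt hh hpos hσ hJ₀.1
    ((minTxPower_le_txCurve hh hpos hσ hJ₀.1 hJ₀.2).trans_lt hp)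
  have hR' : ∀ J ∈ powerSet M j, R ≤ mutualInfo h σ2 P₀ J := fun J hJ =>
    hPI.trans (hsad J hJ P ⟨hP, hPp.le⟩)
  obtain ⟨k, hk, hpk⟩ := exists_lt_txCurve hh hpos hσ hR p
  refine le_trans ?_ (le_csSup ⟨k, ?_⟩ ⟨P₀, hP₀.1, hP₀.2, rfl⟩)
  · obtain ⟨J₁, hJ₁, -, hI₁⟩ := exists_mutualInfo_lt hP₀.1 hk (hP₀.2.trans_lt hpk)
    refine le_csInf ⟨_, J₁, hJ₁, hI₁.le, rfl⟩ ?_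
    rintro _ ⟨J, hJ, hI, rfl⟩
    -- Unused jamming budget, spread evenly over the blocks, would push the rate strictly below `R`,
    -- against the guarantee for `P₀`.
    by_contra! hlt
    have hRJ := hR' J ⟨hJ, hlt.le⟩
    have h1 := mutualInfo_add_const_lt hh hσ hP₀.1 hJ (sub_pos.2 hlt) (hR.trans_le hRJ)
    have h2 := hR' (fun m => J m + (j - frameAvg J))
      ⟨fun m => add_nonneg (hJ m) (sub_pos.2 hlt).le, by
        rw [frameAvg_add, frameAvg_const hM]; linarith⟩
    linarith
  · rintro _ ⟨P, hP, hPp, rfl⟩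
    exact minJxPower_le_of_frameAvg_lt hP hk (hPp.trans_lt hpk)

lemma jxCurve_txCurve (hh : ∀ m, 0 ≤ h m) (hpos : ∃ m, 0 < h m) (hσ : 0 < σ2) (hR : 0 < R)
    {j : ℝ} (hj : 0 ≤ j) : jxCurve h σ2 R (txCurve h σ2 R j) = j := by
  refine (jxCurve_le hh hpos hσ hR hj le_rfl).antisymm (le_of_forall_lt_imp_le_of_dense ?_)
  intro i hi
  rcases lt_or_ge i 0 with h0 | h0
  · exact h0.le.trans (jxCurve_nonneg _)
  · exact le_jxCurve_of_lt hh hpos hσ hR h0 (strictMonoOn_txCurve hh hpos hσ hR h0 hj hi)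

end Curves

/-! ### Abstract curve pairs -/

/-- What the game uses of the two required-power curves. -/
structure IsCurvePair (g q : ℝ → ℝ) : Prop where
  pos : 0 < g 0
  neg : ∀ j < 0, g j = 0
  strictMonoOn : StrictMonoOn g (Set.Ici 0)
  continuousOn : ContinuousOn g (Set.Ici 0)
  unbounded : ∀ c, ∃ j, 0 ≤ j ∧ c < g j
  star : ∀ t j, 0 ≤ t → t ≤ 1 → 0 ≤ j → t * g j ≤ g (t * j)
  inv : ∀ j, 0 ≤ j → q (g j) = j
  zero : ∀ p ≤ g 0, q p = 0

lemma isCurvePair_txCurve_jxCurve {M : ℕ} {h : Fin M → ℝ} {σ2 R : ℝ} (hh : ∀ m, 0 ≤ h m)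
    (hpos : ∃ m, 0 < h m) (hσ : 0 < σ2) (hR : 0 < R) :
    IsCurvePair (txCurve h σ2 R) (jxCurve h σ2 R) where
  pos := txCurve_zero_pos hh hpos hσ hR
  neg _ := txCurve_of_neg
  strictMonoOn := strictMonoOn_txCurve hh hpos hσ hR
  continuousOn := continuousOn_txCurve hh hpos hσ hR
  unbounded := exists_lt_txCurve hh hpos hσ hR
  star _ _ := mul_txCurve_le_txCurve_mul hh hpos hσ hR
  inv _ := jxCurve_txCurve hh hpos hσ hR
  zero _ hp := (jxCurve_le hh hpos hσ hR le_rfl hp).antisymm (jxCurve_nonneg _)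

namespace IsCurvePair

variable {g q : ℝ → ℝ}

lemma lt_iff (H : IsCurvePair g q) {i j : ℝ} (hi : 0 ≤ i) (hj : 0 ≤ j) : g i < g j ↔ i < j :=
  H.strictMonoOn.lt_iff_lt hi hj

lemma le_iff (H : IsCurvePair g q) {i j : ℝ} (hi : 0 ≤ i) (hj : 0 ≤ j) : g i ≤ g j ↔ i ≤ j :=
  H.strictMonoOn.le_iff_le hi hj

lemma pos_of_nonneg (H : IsCurvePair g q) {j : ℝ} (hj : 0 ≤ j) : 0 < g j :=
  H.pos.trans_le ((H.le_iff le_rfl hj).2 hj)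

lemma monotone (H : IsCurvePair g q) : Monotone g := by
  intro i j hij
  rcases lt_or_ge i 0 with hi | hi
  · rw [H.neg i hi]
    rcases lt_or_ge j 0 with hj | hj
    · rw [H.neg j hj]
    · exact (H.pos_of_nonneg hj).le
  · exact (H.le_iff hi (hi.trans hij)).2 hij

lemma exists_eq (H : IsCurvePair g q) {p : ℝ} (hp : g 0 ≤ p) : ∃ j, 0 ≤ j ∧ g j = p := by
  obtain ⟨k, hk, hpk⟩ := H.unbounded p
  obtain ⟨j, hj, rfl⟩ := intermediate_value_Icc hk (H.continuousOn.mono Set.Icc_subset_Ici_self)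
    ⟨hp, hpk.le⟩
  exact ⟨j, hj.1, rfl⟩

/-- A Galois connection: it holds also for `p` below `g 0`, where `q` is not a genuine inverse. -/
lemma q_le_iff (H : IsCurvePair g q) {p j : ℝ} (hj : 0 ≤ j) : q p ≤ j ↔ p ≤ g j := by
  rcases le_total p (g 0) with hp | hp
  · simp [H.zero p hp, hj, hp.trans ((H.le_iff le_rfl hj).2 hj)]
  · obtain ⟨i, hi, rfl⟩ := H.exists_eq hp
    rw [H.inv i hi, H.le_iff hi hj]

lemma q_nonneg (H : IsCurvePair g q) (p : ℝ) : 0 ≤ q p := by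
  rcases le_total p (g 0) with hp | hp
  · rw [H.zero p hp]
  · obtain ⟨i, hi, rfl⟩ := H.exists_eq hp
    rwa [H.inv i hi]

lemma le_g_q (H : IsCurvePair g q) (p : ℝ) : p ≤ g (q p) := (H.q_le_iff (H.q_nonneg p)).1 le_rfl

lemma g_q (H : IsCurvePair g q) {p : ℝ} (hp : g 0 ≤ p) : g (q p) = p := by
  obtain ⟨i, hi, rfl⟩ := H.exists_eq hp
  rw [H.inv i hi]

lemma monotone_q (H : IsCurvePair g q) : Monotone q := fun _ p' hp =>
  (H.q_le_iff (H.q_nonneg _)).2 (hp.trans (H.le_g_q p'))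

lemma intervalIntegrable (H : IsCurvePair g q) (x y : ℝ) : IntervalIntegrable g volume x y :=
  H.monotone.intervalIntegrable

lemma continuous_integral (H : IsCurvePair g q) : Continuous fun w => ∫ y in (0 : ℝ)..w, g y :=
  intervalIntegral.continuous_primitive H.intervalIntegrable 0

lemma mul_le_integral (H : IsCurvePair g q) {x y : ℝ} (hxy : x ≤ y) :
    (y - x) * g x ≤ (∫ t in (0 : ℝ)..y, g t) - ∫ t in (0 : ℝ)..x, g t := by
  rw [intervalIntegral.integral_interval_sub_left (H.intervalIntegrable _ _)
    (H.intervalIntegrable _ _)]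
  have := intervalIntegral.integral_mono_on hxy (intervalIntegrable_const (c := g x))
    (H.intervalIntegrable x y) fun t ht => H.monotone ht.1
  simpa using this

lemma integral_le_mul (H : IsCurvePair g q) {x y : ℝ} (hxy : x ≤ y) :
    (∫ t in (0 : ℝ)..y, g t) - ∫ t in (0 : ℝ)..x, g t ≤ (y - x) * g y := by
  rw [intervalIntegral.integral_interval_sub_left (H.intervalIntegrable _ _)
    (H.intervalIntegrable _ _)]
  have := intervalIntegral.integral_mono_on hxy (H.intervalIntegrable x y)
    (intervalIntegrable_const (c := g y)) fun t ht => H.monotone ht.2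
  simpa using this

lemma integral_lt_mul (H : IsCurvePair g q) {x y : ℝ} (hx : 0 ≤ x) (hxy : x < y) :
    (∫ t in (0 : ℝ)..y, g t) - ∫ t in (0 : ℝ)..x, g t < (y - x) * g y := by
  -- An intermediate point suffices for strictness: to its left `g` stays below `g m`, which is
  -- smaller than `g y`.
  obtain ⟨m, hxm, hmy⟩ := exists_between hxy
  have h1 := H.integral_le_mul hxm.le
  have h2 := H.integral_le_mul hmy.le
  have h3 : (m - x) * g m < (m - x) * g y :=
    mul_lt_mul_of_pos_left ((H.lt_iff (hx.trans hxm.le) (hx.trans hxy.le)).2 hmy)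
      (sub_pos.2 hxm)
  linarith

/-- By star-shapedness `g` lies above its chord from the origin, and the triangle under the chord
has this area. -/
lemma half_mul_le_integral (H : IsCurvePair g q) {w : ℝ} (hw : 0 < w) :
    w * g w / 2 ≤ ∫ t in (0 : ℝ)..w, g t := by
  have := intervalIntegral.integral_mono_on hw.le (f := fun t => t * (g w / w))
    (Continuous.intervalIntegrable (by fun_prop) 0 w) (H.intervalIntegrable 0 w) fun t ht => by
      have := H.star (t / w) w (div_nonneg ht.1 hw.le) ((div_le_one hw).2 ht.2) hw.le
      rwa [div_mul_cancel₀ _ hw.ne', div_mul_eq_mul_div, mul_div_assoc] at this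
  rw [intervalIntegral.integral_mul_const, integral_id] at this
  refine le_trans (le_of_eq ?_) this
  field_simp
  ring

lemma mul_sub_le_mul_sub (H : IsCurvePair g q) {a b w w' : ℝ} (hbw : b ≤ w)
    (haw : a ≤ g w) (hw : w ≤ w') : (g w - a) * (w - b) ≤ (g w' - a) * (w' - b) := by
  have h1 := H.monotone hw
  exact mul_le_mul (by linarith) (by linarith) (by linarith) (by linarith)

lemma exists_unique_crossing (H : IsCurvePair g q) {a b : ℝ} (ha : 0 < a) (hb : 0 < b) :
    ∃ w₀, b < w₀ ∧ a < g w₀ ∧ a * b = (g w₀ - a) * (w₀ - b) ∧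
      ∀ w, 0 ≤ w → a * b = (g w - a) * (w - b) → w = w₀ := by
  have hab : 0 < a * b := mul_pos ha hb
  have key : ∀ w, 0 ≤ w → a * b = (g w - a) * (w - b) → b < w ∧ a < g w := by
    intro w hw he
    rcases pos_and_pos_or_neg_and_neg_of_mul_pos (he ▸ hab) with h | h
    · exact ⟨sub_pos.1 h.2, sub_pos.1 h.1⟩
    -- Both factors negative is impossible: then `a - g w < a` and `b - w ≤ b`, so their product is
    -- less than `a * b`.
    · have h1 := H.pos_of_nonneg hw
      have h2 : (a - g w) * (b - w) < a * b :=
        mul_lt_mul (by linarith) (by linarith) (by linarith) ha.le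
      have h3 : (a - g w) * (b - w) = (g w - a) * (w - b) := by ring
      linarith
  have uniq : ∀ w w', 0 ≤ w → w < w' → a * b = (g w - a) * (w - b) →
      a * b ≠ (g w' - a) * (w' - b) := by
    intro w w' hw hww he he'
    obtain ⟨h1, h2⟩ := key w hw he
    have h3 := (H.lt_iff hw (hw.trans hww.le)).2 hww
    have : (g w - a) * (w - b) < (g w' - a) * (w' - b) :=
      mul_lt_mul'' (by linarith) (by linarith) (by linarith) (by linarith)
    linarith
  obtain ⟨k, hk, hak⟩ := H.unbounded (2 * a)
  have hcont : ContinuousOn (fun w => (g w - a) * (w - b)) (Set.Icc b (max k (2 * b))) :=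
    ((H.continuousOn.mono fun x hx => hb.le.trans hx.1).sub continuousOn_const).mul
      (by fun_prop)
  have hmem : a * b ∈ Set.Icc ((g b - a) * (b - b))
      ((g (max k (2 * b)) - a) * (max k (2 * b) - b)) := by
    refine ⟨by rw [sub_self, mul_zero]; exact hab.le, ?_⟩
    have h1 := H.monotone (le_max_left k (2 * b))
    have h2 := le_max_right k (2 * b)
    exact mul_le_mul (by linarith) (by linarith) hb.le (by linarith)
  obtain ⟨w₀, hw₀, he⟩ := intermediate_value_Icc
    (show b ≤ max k (2 * b) from le_max_of_le_right (by linarith)) hcont hmem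
  have hw₀0 : 0 ≤ w₀ := hb.le.trans hw₀.1
  obtain ⟨h1, h2⟩ := key w₀ hw₀0 he.symm
  refine ⟨w₀, h1, h2, he.symm, fun w hw hew => ?_⟩
  rcases lt_trichotomy w w₀ with hlt | heq | hlt
  · exact absurd he.symm (uniq w w₀ hw hlt hew)
  · exact heq
  · exact absurd hew (uniq w₀ w hw₀0 hlt he.symm)

/-- At a root, `a` is the mean of the increasing function `g` over `[0, u]`, so `a < g u` and the
expression increases strictly from there on. -/
lemma exists_unique_integral_eq (H : IsCurvePair g q) {a w₀ : ℝ} (hw₀ : 0 < w₀)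
    (hS : (∫ y in (0 : ℝ)..w₀, g y) - w₀ * a < 0) :
    ∃ w, w₀ ≤ w ∧ ∀ u, (0 < u ∧ (∫ y in (0 : ℝ)..u, g y) - u * a = 0) ↔ u = w := by
  have uniq : ∀ u u', 0 < u → u < u' → (∫ y in (0 : ℝ)..u, g y) - u * a = 0 →
      (∫ y in (0 : ℝ)..u', g y) - u' * a ≠ 0 := by
    intro u u' hu huu he he'
    have h1 := H.integral_lt_mul le_rfl hu
    have h2 := H.mul_le_integral huu.le
    rw [intervalIntegral.integral_same] at h1
    have h3 : a < g u := lt_of_mul_lt_mul_left (by linarith : u * a < u * g u) hu.le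
    have h4 := mul_lt_mul_of_pos_left h3 (sub_pos.2 huu)
    linarith
  obtain ⟨k, hk, hak⟩ := H.unbounded (a + 1)
  set m := max w₀ k with hm
  set D := w₀ * a - (∫ y in (0 : ℝ)..w₀, g y) with hD
  have hgm : a + 1 ≤ g m := hak.le.trans (H.monotone (le_max_right _ _))
  -- Beyond `m` the expression grows at least at unit rate, so an interval as long as its absolute
  -- value at `m` makes it nonnegative.
  set L := m + |m * a - ∫ y in (0 : ℝ)..m, g y| with hL
  have hmL : m ≤ L := le_add_of_nonneg_right (abs_nonneg _)
  have hcont : Continuous fun u => (∫ y in (0 : ℝ)..u, g y) - u * a :=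
    H.continuous_integral.sub (by fun_prop)
  have hmem : (0 : ℝ) ∈ Set.Icc ((∫ y in (0 : ℝ)..w₀, g y) - w₀ * a)
      ((∫ y in (0 : ℝ)..L, g y) - L * a) := by
    refine ⟨hS.le, ?_⟩
    have h1 := H.mul_le_integral hmL
    have h2 := le_abs_self (m * a - ∫ y in (0 : ℝ)..m, g y)
    have h3 := mul_le_mul_of_nonneg_left hgm (sub_nonneg.2 hmL)
    have h4 : L - m = |m * a - ∫ y in (0 : ℝ)..m, g y| := by rw [hL]; ring
    linarith
  obtain ⟨w, hw, he⟩ := intermediate_value_Icc ((le_max_left w₀ k).trans hmL)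
    hcont.continuousOn hmem
  have hw0 : 0 < w := hw₀.trans_le hw.1
  refine ⟨w, hw.1, fun u => ⟨fun ⟨hu, heu⟩ => ?_, ?_⟩⟩
  · rcases lt_trichotomy u w with hlt | heq | hlt
    · exact absurd he (uniq u w hu hlt heu)
    · exact heq
    · exact absurd heu (uniq w u hw0 hlt he)
  · rintro rfl
    exact ⟨hw0, he⟩

/-- Roots lie beyond `b`. From `u` to `u'` the integral gains at most `(u' - u) * g u'`, so the
expression falls by at least `(g u' - g u) * (u - b) > 0`. -/
lemma exists_unique_integral_eq_mul (H : IsCurvePair g q) {b w₀ : ℝ} (hb : 0 < b) (hw₀ : b < w₀)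
    (hS : 0 < (∫ y in (0 : ℝ)..w₀, g y) - g w₀ * (w₀ - b)) :
    ∃ w, w₀ ≤ w ∧ ∀ u, (0 ≤ u ∧ (∫ y in (0 : ℝ)..u, g y) - g u * (u - b) = 0) ↔ u = w := by
  have key : ∀ u, 0 ≤ u → (∫ y in (0 : ℝ)..u, g y) - g u * (u - b) = 0 → b < u := by
    intro u hu he
    by_contra! hle
    have h1 := H.mul_le_integral hu
    rw [intervalIntegral.integral_same] at h1
    have h2 := H.pos
    have h3 := H.pos_of_nonneg hu
    rcases hu.eq_or_lt with rfl | hu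
    · simp only [intervalIntegral.integral_same] at he
      have := mul_pos h2 hb
      linarith
    · have h4 : 0 < u * g 0 := mul_pos hu h2
      have h5 : g u * (u - b) ≤ 0 := mul_nonpos_of_nonneg_of_nonpos h3.le (by linarith)
      linarith
  have uniq : ∀ u u', 0 ≤ u → u < u' → (∫ y in (0 : ℝ)..u, g y) - g u * (u - b) = 0 →
      (∫ y in (0 : ℝ)..u', g y) - g u' * (u' - b) ≠ 0 := by
    intro u u' hu huu he he'
    have h1 := H.integral_le_mul huu.le
    have h2 := mul_lt_mul_of_pos_right ((H.lt_iff hu (hu.trans huu.le)).2 huu)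
      (sub_pos.2 (key u hu he))
    linarith
  -- On the last unit before `w₀ + 1` the product keeps a surplus `g L`; choosing `g L` above the
  -- integral up to `w₀ + 1` makes the expression nonpositive at `L`.
  obtain ⟨k, hk, hak⟩ := H.unbounded (∫ y in (0 : ℝ)..(w₀ + 1), g y)
  set L := max (w₀ + 1) k with hL
  have hmL : w₀ + 1 ≤ L := le_max_left _ _
  have hL0 : 0 ≤ L := by linarith
  have hcont : ContinuousOn (fun u => (∫ y in (0 : ℝ)..u, g y) - g u * (u - b))
      (Set.Icc w₀ L) :=
    H.continuous_integral.continuousOn.sub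
      ((H.continuousOn.mono fun x hx => (hb.le.trans hw₀.le).trans hx.1).mul (by fun_prop))
  have hmem : (0 : ℝ) ∈ Set.Icc ((∫ y in (0 : ℝ)..L, g y) - g L * (L - b))
      ((∫ y in (0 : ℝ)..w₀, g y) - g w₀ * (w₀ - b)) := by
    refine ⟨?_, hS.le⟩
    have h1 := H.integral_le_mul hmL
    have h2 := H.monotone (le_max_right (w₀ + 1) k)
    have h3 := H.pos_of_nonneg hL0
    have h4 : 0 ≤ g L * (w₀ - b) := mul_nonneg h3.le (by linarith)
    have h5 : (L - (w₀ + 1)) * g L = g L * (L - b) - g L - g L * (w₀ - b) := by ring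
    linarith
  obtain ⟨w, hw, he⟩ := intermediate_value_Icc' (by linarith : w₀ ≤ L) hcont hmem
  have hw0 : 0 ≤ w := (hb.le.trans hw₀.le).trans hw.1
  refine ⟨w, hw.1, fun u => ⟨fun ⟨hu, heu⟩ => ?_, ?_⟩⟩
  · rcases lt_trichotomy u w with hlt | heq | hlt
    · exact absurd he (uniq u w hu hlt heu)
    · exact heq
    · exact absurd heu (uniq w u hw0 hlt he)
  · rintro rfl
    exact ⟨hw0, he⟩

end IsCurvePair

/-! ### Equilibrium parameters -/

/-- The equations that the support `[0, w]` of the jammer's strategy and the weights `kp`, `kj` of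
the continuous parts satisfy in equilibrium. -/
structure IsEquilibriumParam (g : ℝ → ℝ) (a b w kp kj : ℝ) : Prop where
  b_lt : b < w
  a_lt : a < g w
  kp_pos : 0 < kp
  kp_le : kp ≤ 1
  kj_pos : 0 < kj
  kj_le : kj ≤ 1
  eq_p : kp * (∫ y in (0 : ℝ)..w, g y) = w * a
  eq_j : kj * (w * g w - ∫ y in (0 : ℝ)..w, g y) = b * g w
  eq_one : kp = 1 ∨ kj = 1

lemma IsEquilibriumParam.two_mul_le {g q : ℝ → ℝ} (H : IsCurvePair g q) {a b w kp kj : ℝ}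
    (hb : 0 < b) (E : IsEquilibriumParam g a b w kp kj) : 2 * b ≤ w := by
  have hw : 0 < w := hb.trans E.b_lt
  have h1 := H.half_mul_le_integral hw
  have h2 := H.pos_of_nonneg hw.le
  have h3 := H.integral_le_mul hw.le
  rw [intervalIntegral.integral_same] at h3
  have h4 := mul_le_of_le_one_left
    (show 0 ≤ w * g w - ∫ y in (0 : ℝ)..w, g y by linarith) E.kj_le
  rw [E.eq_j] at h4
  have h5 : (2 * b) * g w ≤ w * g w := by linarith
  exact le_of_mul_le_mul_right h5 h2

lemma IsEquilibriumParam.value_eq {g q : ℝ → ℝ} (H : IsCurvePair g q) {a b w kp kj : ℝ}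
    (hb : 0 < b) (E : IsEquilibriumParam g a b w kp kj) :
    (1 - kp) + kp * (b / w) = kj * (1 - a / g w) := by
  have hw : 0 < w := hb.trans E.b_lt
  have h2 := H.pos_of_nonneg hw.le
  have h3 := E.eq_p
  have h4 := E.eq_j
  field_simp
  rcases E.eq_one with h | h
  · subst h
    rw [one_mul] at h3
    rw [h3] at h4
    linear_combination -h4
  · subst h
    have h5 : (∫ y in (0 : ℝ)..w, g y) = w * g w - b * g w := by linarith
    rw [h5] at h3
    linear_combination -h3

/-- The parameters of the equilibrium exist and are determined as stated. -/
lemma IsCurvePair.exists_equilibriumParam {g q : ℝ → ℝ} (H : IsCurvePair g q) {a b : ℝ}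
    (ha : 0 < a) (hb : 0 < b) :
    ∃ w₀ w kp kj S : ℝ,
      (∀ u : ℝ, (0 ≤ u ∧ a * b = (g u - a) * (u - b)) ↔ u = w₀) ∧
      S = (∫ y in (0 : ℝ)..w₀, g y) - w₀ * a ∧
      IsEquilibriumParam g a b w kp kj ∧
      (S < 0 →
        (∀ u : ℝ, (0 < u ∧ (∫ y in (0 : ℝ)..u, g y) - u * a = 0) ↔ u = w) ∧
        kp = 1 ∧ kj = b * g w / (w * (g w - a))) ∧
      (S = 0 → w = w₀ ∧ kp = 1 ∧ kj = 1) ∧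
      (0 < S →
        (∀ u : ℝ, (0 ≤ u ∧ (∫ y in (0 : ℝ)..u, g y) - g u * (u - b) = 0) ↔ u = w) ∧
        kp = w * a / (g w * (w - b)) ∧ kj = 1) := by
  obtain ⟨w₀, hbw, haw, he, huniq⟩ := H.exists_unique_crossing ha hb
  have hw₀ : 0 < w₀ := hb.trans hbw
  have hsol : ∀ u : ℝ, (0 ≤ u ∧ a * b = (g u - a) * (u - b)) ↔ u = w₀ := fun u =>
    ⟨fun h => huniq u h.1 h.2, by rintro rfl; exact ⟨hw₀.le, he⟩⟩
  -- Expanded, this inequality reads `b * g w ≤ w * (g w - a)`, or equally `w * a ≤ g w * (w - b)`: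
  -- it is the bound by `1` on `kj` and on `kp` in the two unequal cases.
  have hge : ∀ w, w₀ ≤ w → a * b ≤ (g w - a) * (w - b) := fun w hw =>
    he.le.trans (H.mul_sub_le_mul_sub hbw.le haw.le hw)
  have hgw : ∀ w, w₀ ≤ w → a < g w := fun w hw => haw.trans_le (H.monotone hw)
  rcases lt_trichotomy ((∫ y in (0 : ℝ)..w₀, g y) - w₀ * a) 0 with hS | hS | hS
  · obtain ⟨w, hw, hwu⟩ := H.exists_unique_integral_eq hw₀ hS
    have hw0 : 0 < w := hw₀.trans_le hw
    have hg := H.pos_of_nonneg hw0.le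
    have hga := sub_pos.2 (hgw w hw)
    have heq := ((hwu w).2 rfl).2
    have hab := hge w hw
    refine ⟨w₀, w, 1, b * g w / (w * (g w - a)), _, hsol, rfl,
      ⟨hbw.trans_le hw, hgw w hw, one_pos, le_rfl, by positivity, ?_, by linarith, ?_, .inl rfl⟩,
      fun _ => ⟨hwu, rfl, rfl⟩, fun h => absurd h hS.ne, fun h => absurd h hS.not_gt⟩
    · rw [div_le_one (by positivity)]
      linarith
    · have : (∫ y in (0 : ℝ)..w, g y) = w * a := by linarith
      rw [this, ← mul_sub, div_mul_cancel₀ _ (by positivity)]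
  · have : (∫ y in (0 : ℝ)..w₀, g y) = w₀ * a := by linarith
    exact ⟨w₀, w₀, 1, 1, _, hsol, rfl,
      ⟨hbw, haw, one_pos, le_rfl, one_pos, le_rfl, by linarith, by linarith, .inl rfl⟩,
      fun h => absurd hS h.ne, fun _ => ⟨rfl, rfl, rfl⟩, fun h => absurd hS h.ne'⟩
  -- The equation of `w₀` is equivalent to `g w₀ * (w₀ - b) = w₀ * a`.
  · have hS' : 0 < (∫ y in (0 : ℝ)..w₀, g y) - g w₀ * (w₀ - b) := by linarith
    obtain ⟨w, hw, hwu⟩ := H.exists_unique_integral_eq_mul hb hbw hS'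
    have hw0 : 0 < w := hw₀.trans_le hw
    have hg := H.pos_of_nonneg hw0.le
    have hwb : 0 < w - b := sub_pos.2 (hbw.trans_le hw)
    have heq := ((hwu w).2 rfl).2
    have hab := hge w hw
    refine ⟨w₀, w, w * a / (g w * (w - b)), 1, _, hsol, rfl,
      ⟨hbw.trans_le hw, hgw w hw, by positivity, ?_, one_pos, le_rfl, ?_, by linarith, .inr rfl⟩,
      fun h => absurd h hS.not_gt, fun h => absurd h hS.ne', fun _ => ⟨hwu, rfl, rfl⟩⟩
    · rw [div_le_one (by positivity)]
      linarith
    · have : (∫ y in (0 : ℝ)..w, g y) = g w * (w - b) := by linarith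
      rw [this, div_mul_cancel₀ _ (by positivity)]

/-! ### Uniform laws and their mixtures with an atom at zero -/

section Unif

variable {t : ℝ}

lemma unif_eq (ht : 0 < t) :
    unif t = ENNReal.ofReal t⁻¹ • (volume.restrict (Set.Icc 0 t)) := by
  rw [unif, ProbabilityTheory.cond, Real.volume_Icc, sub_zero, ENNReal.ofReal_inv_of_pos ht]

lemma isProbabilityMeasure_unif (ht : 0 < t) : IsProbabilityMeasure (unif t) := by
  refine cond_isProbabilityMeasure_of_finite ?_ ?_ <;> simp [ht]

lemma integral_unif (ht : 0 < t) (f : ℝ → ℝ) :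
    ∫ x, f x ∂unif t = (∫ x in (0 : ℝ)..t, f x) / t := by
  rw [unif_eq ht, integral_smul_measure, ENNReal.toReal_ofReal (inv_nonneg.2 ht.le),
    integral_Icc_eq_integral_Ioc, ← intervalIntegral.integral_of_le ht.le, smul_eq_mul]
  ring

lemma integrable_unif (ht : 0 < t) {f : ℝ → ℝ} (hf : IntervalIntegrable f volume 0 t) :
    Integrable f (unif t) := by
  rw [unif_eq ht]
  refine Integrable.smul_measure ?_ ENNReal.ofReal_ne_top
  rwa [← IntegrableOn, integrableOn_Icc_iff_integrableOn_Ioc,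
    ← intervalIntegrable_iff_integrableOn_Ioc_of_le ht.le]

lemma ae_unif_mem (ht : 0 < t) : ∀ᵐ x ∂unif t, x ∈ Set.Ioc 0 t := by
  rw [unif_eq ht]
  refine Measure.ae_smul_measure ?_ _
  rw [← Measure.restrict_congr_set Ioc_ae_eq_Icc]
  exact ae_restrict_mem measurableSet_Ioc

lemma unif_real_Iic (ht : 0 < t) {x : ℝ} (hx : 0 ≤ x) :
    (unif t).real (Set.Iic x) = min (x / t) 1 := by
  rw [unif_eq ht, measureReal_ennreal_smul_apply, ENNReal.toReal_ofReal (inv_nonneg.2 ht.le),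
    measureReal_restrict_apply measurableSet_Iic]
  have : Set.Iic x ∩ Set.Icc 0 t = Set.Icc 0 (min x t) := by
    ext y; simp only [Set.mem_inter_iff, Set.mem_Iic, Set.mem_Icc, le_min_iff]; tauto
  rw [this, Real.volume_real_Icc_of_le (le_min hx ht.le), sub_zero, mul_comm, ← div_eq_mul_inv,
    ← min_div_div_right ht.le, div_self ht.ne']

lemma unif_real_Ioi (ht : 0 < t) {x : ℝ} (hx : 0 ≤ x) :
    (unif t).real (Set.Ioi x) = 1 - min (x / t) 1 := by
  have := isProbabilityMeasure_unif ht
  rw [← Set.compl_Iic, probReal_compl_eq_one_sub measurableSet_Iic, unif_real_Iic ht hx]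

lemma exists_mem_Ioo_of_ae_unif (ht : 0 < t) {p : ℝ → Prop} (hp : ∀ᵐ x ∂unif t, p x) {x y : ℝ}
    (hx : 0 ≤ x) (hxy : x < y) (hy : y ≤ t) : ∃ z ∈ Set.Ioo x y, p z := by
  by_contra! hne
  have hsub : Set.Ioo x y ⊆ Set.Icc 0 t := fun z hz => ⟨hx.trans hz.1.le, hz.2.le.trans hy⟩
  have h0 : unif t (Set.Ioo x y) = 0 := measure_mono_null (fun z hz => hne z hz) hp
  rw [unif_eq ht, Measure.smul_apply, Measure.restrict_apply measurableSet_Ioo,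
    Set.inter_eq_left.2 hsub, Real.volume_Ioo, smul_eq_mul, mul_eq_zero, ENNReal.ofReal_eq_zero,
    ENNReal.ofReal_eq_zero] at h0
  rcases h0 with h0 | h0
  · exact (inv_pos.2 ht).not_ge h0
  · linarith

end Unif

section MixLaw

variable {k t : ℝ} {f : ℝ → ℝ}

lemma isProbabilityMeasure_mixLaw (hk : 0 ≤ k) (hk1 : k ≤ 1) (ht : 0 < t) (hf : Measurable f) :
    IsProbabilityMeasure (mixLaw k t f) := by
  have := isProbabilityMeasure_unif ht
  have := Measure.isProbabilityMeasure_map (μ := unif t) hf.aemeasurable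
  constructor
  simp only [mixLaw, Measure.add_apply, Measure.smul_apply, measure_univ, smul_eq_mul, mul_one]
  rw [← ENNReal.ofReal_add hk (sub_nonneg.2 hk1), add_sub_cancel, ENNReal.ofReal_one]

lemma mixLaw_real_apply (hk : 0 ≤ k) (hk1 : k ≤ 1) (ht : 0 < t) (hf : Measurable f) {s : Set ℝ}
    (hs : MeasurableSet s) :
    (mixLaw k t f).real s =
      k * (unif t).real (f ⁻¹' s) + (1 - k) * (Measure.dirac 0).real s := by
  have := isProbabilityMeasure_unif ht
  have := Measure.isProbabilityMeasure_map (μ := unif t) hf.aemeasurable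
  have hfin : ∀ (c : ℝ) (ν : Measure ℝ) [IsProbabilityMeasure ν],
      (ENNReal.ofReal c • ν) s ≠ ⊤ := fun c ν _ =>
    ENNReal.mul_ne_top ENNReal.ofReal_ne_top (measure_ne_top ν s)
  rw [mixLaw, measureReal_add_apply (hfin _ _) (hfin _ _), measureReal_ennreal_smul_apply,
    measureReal_ennreal_smul_apply, ENNReal.toReal_ofReal hk,
    ENNReal.toReal_ofReal (sub_nonneg.2 hk1), map_measureReal_apply hf hs]

lemma integral_mixLaw (hk : 0 ≤ k) (ht : 0 < t) (hf : Measurable f)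
    (hfi : IntervalIntegrable f volume 0 t) :
    Integrable (fun x : ℝ => x) (mixLaw k t f) ∧
      ∫ x, x ∂mixLaw k t f = k * ((∫ x in (0 : ℝ)..t, f x) / t) := by
  have h0 : Integrable (fun x : ℝ => x) ((unif t).map f) :=
    (integrable_map_measure (by fun_prop) hf.aemeasurable).2 (integrable_unif ht (f := f) hfi)
  have h1 : Integrable (fun x : ℝ => x) (ENNReal.ofReal k • (unif t).map f) :=
    h0.smul_measure ENNReal.ofReal_ne_top
  have h2 : Integrable (fun x : ℝ => x) (ENNReal.ofReal (1 - k) • Measure.dirac (0 : ℝ)) :=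
    (integrable_dirac (by simp)).smul_measure ENNReal.ofReal_ne_top
  refine ⟨h1.add_measure h2, ?_⟩
  rw [mixLaw, integral_add_measure h1 h2, integral_smul_measure, integral_smul_measure,
    integral_dirac, integral_map hf.aemeasurable (by fun_prop), integral_unif ht,
    ENNReal.toReal_ofReal hk]
  simp

lemma ae_mixLaw_of (ht : 0 < t) (hf : Measurable f) {p : ℝ → Prop}
    (hp : MeasurableSet {x | p x}) (h0 : p 0) (h : ∀ x ∈ Set.Ioc 0 t, p (f x)) :
    ∀ᵐ x ∂mixLaw k t f, p x := by
  rw [mixLaw, ae_add_measure_iff]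
  refine ⟨Measure.ae_smul_measure ?_ _, Measure.ae_smul_measure ?_ _⟩
  · rw [ae_map_iff hf.aemeasurable hp]
    filter_upwards [ae_unif_mem ht] with x hx using h x hx
  · rw [ae_dirac_iff hp]
    exact h0

lemma exists_mem_Ioo_of_ae_mixLaw (hk : 0 < k) (ht : 0 < t) (hf : Measurable f) {p : ℝ → Prop}
    (hp : ∀ᵐ x ∂mixLaw k t f, p x) {x y : ℝ} (hx : 0 ≤ x) (hxy : x < y) (hy : y ≤ t) :
    ∃ z ∈ Set.Ioo x y, p (f z) := by
  rw [mixLaw, ae_add_measure_iff, Measure.ae_ennreal_smul_measure_iff (by simpa using hk)] at hp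
  exact exists_mem_Ioo_of_ae_unif ht (ae_of_ae_map hf.aemeasurable hp.1) hx hxy hy

end MixLaw

/-! ### The candidate strategies and their means -/

section Strategies

variable {g q : ℝ → ℝ}

/-- Young's identity for the inverse curves `g` and `q`. -/
lemma IsCurvePair.integral_q (H : IsCurvePair g q) {w : ℝ} (hw : 0 < w) :
    ∫ x in (0 : ℝ)..g w, q x = w * g w - ∫ y in (0 : ℝ)..w, g y := by
  have hgw := H.pos_of_nonneg hw.le
  have hint : Integrable q (volume.restrict (Set.Ioc 0 (g w))) :=
    (intervalIntegrable_iff_integrableOn_Ioc_of_le hgw.le).1 H.monotone_q.intervalIntegrable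
  -- Layer cake: the superlevel set of `q` at height `y` is `Set.Ioi (g y)`.
  rw [intervalIntegral.integral_of_le hgw.le,
    hint.integral_eq_integral_meas_lt (Filter.Eventually.of_forall H.q_nonneg)]
  have hmeas : ∀ y ∈ Set.Ioi (0 : ℝ), (volume.restrict (Set.Ioc 0 (g w))).real {x | y < q x} =
      (Set.Ioc 0 w).indicator (fun y => g w - g y) y := by
    intro y hy
    rw [Set.mem_Ioi] at hy
    have hset : {x | y < q x} = Set.Ioi (g y) := by
      ext x
      rw [Set.mem_ofPred_eq, Set.mem_Ioi, ← not_le, H.q_le_iff hy.le, not_le]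
    have hinter : Set.Ioi (g y) ∩ Set.Ioc 0 (g w) = Set.Ioc (g y) (g w) := by
      ext x
      simp only [Set.mem_inter_iff, Set.mem_Ioi, Set.mem_Ioc]
      have := H.pos_of_nonneg hy.le
      constructor
      · rintro ⟨h1, h2, h3⟩; exact ⟨h1, h3⟩
      · rintro ⟨h1, h2⟩; exact ⟨h1, this.trans h1, h2⟩
    rw [hset, measureReal_restrict_apply measurableSet_Ioi, hinter]
    rcases le_or_gt y w with hyw | hyw
    · rw [Set.indicator_of_mem (show y ∈ Set.Ioc 0 w from ⟨hy, hyw⟩),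
        Real.volume_real_Ioc_of_le (H.monotone hyw)]
    · rw [Set.indicator_of_notMem (fun h => hyw.not_ge h.2), Set.Ioc_eq_empty
        (H.monotone hyw.le).not_gt, measureReal_empty]
  rw [setIntegral_congr_fun measurableSet_Ioi hmeas, setIntegral_indicator measurableSet_Ioc,
    Set.inter_eq_right.2 Set.Ioc_subset_Ioi_self, ← intervalIntegral.integral_of_le hw.le,
    intervalIntegral.integral_sub intervalIntegrable_const (H.intervalIntegrable 0 w)]
  simp

lemma IsCurvePair.measurable (H : IsCurvePair g q) : Measurable g := H.monotone.measurable

lemma IsCurvePair.measurable_q (H : IsCurvePair g q) : Measurable q := H.monotone_q.measurable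

variable {a b w kp kj : ℝ}

lemma integral_txLaw (H : IsCurvePair g q) (hb : 0 < b) (E : IsEquilibriumParam g a b w kp kj) :
    ∫ x, x ∂mixLaw kp w g = a := by
  have hw : 0 < w := hb.trans E.b_lt
  rw [(integral_mixLaw E.kp_pos.le hw H.measurable (H.intervalIntegrable 0 w)).2,
    mul_div_assoc', E.eq_p, mul_div_cancel_left₀ _ hw.ne']

lemma integral_jxLaw (H : IsCurvePair g q) (hb : 0 < b) (E : IsEquilibriumParam g a b w kp kj) :
    ∫ x, x ∂mixLaw kj (g w) q = b := by
  have hw : 0 < w := hb.trans E.b_lt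
  have hg := H.pos_of_nonneg hw.le
  rw [(integral_mixLaw E.kj_pos.le hg H.measurable_q H.monotone_q.intervalIntegrable).2,
    H.integral_q hw, mul_div_assoc', E.eq_j, mul_div_cancel_right₀ _ hg.ne']

lemma isMixedStrategy_txLaw (H : IsCurvePair g q) (hb : 0 < b)
    (E : IsEquilibriumParam g a b w kp kj) : IsMixedStrategy a (mixLaw kp w g) := by
  have hw : 0 < w := hb.trans E.b_lt
  exact ⟨isProbabilityMeasure_mixLaw E.kp_pos.le E.kp_le hw H.measurable,
    ae_mixLaw_of hw H.measurable measurableSet_Ici le_rfl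
      fun x hx => (H.pos_of_nonneg hx.1.le).le,
    (integral_mixLaw E.kp_pos.le hw H.measurable (H.intervalIntegrable 0 w)).1,
    (integral_txLaw H hb E).le⟩

lemma isMixedStrategy_jxLaw (H : IsCurvePair g q) (hb : 0 < b)
    (E : IsEquilibriumParam g a b w kp kj) : IsMixedStrategy b (mixLaw kj (g w) q) := by
  have hg := H.pos_of_nonneg (hb.trans E.b_lt).le
  exact ⟨isProbabilityMeasure_mixLaw E.kj_pos.le E.kj_le hg H.measurable_q,
    ae_mixLaw_of hg H.measurable_q measurableSet_Ici le_rfl fun x _ => H.q_nonneg x,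
    (integral_mixLaw E.kj_pos.le hg H.measurable_q H.monotone_q.intervalIntegrable).1,
    (integral_jxLaw H hb E).le⟩

lemma dirac_zero_real_Iic {x : ℝ} (hx : 0 ≤ x) : (Measure.dirac (0 : ℝ)).real (Set.Iic x) = 1 := by
  rw [measureReal_def, Measure.dirac_apply' _ measurableSet_Iic, Set.indicator_of_mem]
  · simp
  · exact hx

lemma txLaw_real_Iic (H : IsCurvePair g q) (hw : 0 < w) (hk : 0 ≤ kp) (hk1 : kp ≤ 1) {y : ℝ}
    (hy : 0 ≤ y) :
    (mixLaw kp w g).real (Set.Iic (g y)) = kp * (unif w).real (Set.Iic y) + (1 - kp) := by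
  rw [mixLaw_real_apply hk hk1 hw H.measurable measurableSet_Iic,
    dirac_zero_real_Iic (H.pos_of_nonneg hy).le, mul_one]
  congr 2
  refine measureReal_congr ?_
  filter_upwards [ae_unif_mem hw] with x hx
  exact propext (H.le_iff hx.1.le hy)

lemma jxLaw_real_Iic (H : IsCurvePair g q) {t : ℝ} (ht : 0 < t) (hk : 0 ≤ kj) (hk1 : kj ≤ 1)
    {y : ℝ} (hy : 0 ≤ y) :
    (mixLaw kj t q).real (Set.Iic y) = kj * (unif t).real (Set.Iic (g y)) + (1 - kj) := by
  rw [mixLaw_real_apply hk hk1 ht H.measurable_q measurableSet_Iic, dirac_zero_real_Iic hy,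
    mul_one]
  congr 3
  ext x
  exact H.q_le_iff hy

end Strategies

/-! ### Supporting lines, two-point laws and truncated means -/

/-- A supporting line at `b` of a function on `[0, ∞)` whose two-point averages over
distributions of mean `b` are at most `V`. -/
lemma exists_supporting_line {φ : ℝ → ℝ} {b V : ℝ} (hb : 0 < b)
    (H : ∀ i j t : ℝ, 0 ≤ i → 0 ≤ j → 0 ≤ t → t ≤ 1 → t * i + (1 - t) * j = b →
      t * φ i + (1 - t) * φ j ≤ V) :
    ∃ α β, α + β * b = V ∧ ∀ j, 0 ≤ j → φ j ≤ α + β * j := by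
  have key : ∀ i j, 0 ≤ i → i < b → b < j → (φ j - V) / (j - b) ≤ (V - φ i) / (b - i) := by
    intro i j hi hib hbj
    have h1 : 0 < b - i := sub_pos.2 hib
    have h2 : 0 < j - b := sub_pos.2 hbj
    have h3 : 0 < j - i := by linarith
    have := H i j ((j - b) / (j - i)) hi (by linarith) (by positivity)
      ((div_le_one h3).2 (by linarith)) (by field_simp; ring)
    rw [div_le_div_iff₀ h2 h1]
    have e : (j - b) / (j - i) * φ i + (1 - (j - b) / (j - i)) * φ j =
      ((j - b) * φ i + (b - i) * φ j) / (j - i) := by field_simp; ring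
    rw [e, div_le_iff₀ h3] at this
    linarith
  -- The slopes from points on the left of `b` to `(b, V)`. By `key` each slope on the right bounds
  -- them below, so their infimum serves both sides.
  set s := (fun i => (V - φ i) / (b - i)) '' Set.Ico 0 b with hs
  have hne : s.Nonempty := ⟨_, 0, ⟨le_rfl, hb⟩, rfl⟩
  refine ⟨V - sInf s * b, sInf s, by ring, fun j hj => ?_⟩
  rcases lt_trichotomy j b with h | h | h
  · have h1 : sInf s ≤ (V - φ j) / (b - j) := by
      refine csInf_le ⟨(φ (b + 1) - V) / (b + 1 - b), ?_⟩ ⟨j, ⟨hj, h⟩, rfl⟩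
      rintro _ ⟨i, hi, rfl⟩
      exact key i (b + 1) hi.1 hi.2 (by linarith)
    rw [le_div_iff₀ (sub_pos.2 h)] at h1
    linarith
  · have := H j j 1 hj hj zero_le_one le_rfl (by linarith)
    rw [h] at this ⊢
    linarith
  · have h1 : (φ j - V) / (j - b) ≤ sInf s := by
      refine le_csInf hne ?_
      rintro _ ⟨i, hi, rfl⟩
      exact key i j hi.1 hi.2 h
    rw [div_le_iff₀ (sub_pos.2 h)] at h1
    linarith

section TwoPoint

variable {t i j : ℝ}

/-- The law that is `i` with probability `t` and `j` with probability `1 - t`. -/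
def twoPoint (t i j : ℝ) : Measure ℝ :=
  ENNReal.ofReal t • Measure.dirac i + ENNReal.ofReal (1 - t) • Measure.dirac j

lemma integral_twoPoint (ht : 0 ≤ t) (ht1 : t ≤ 1) (f : ℝ → ℝ) :
    Integrable f (twoPoint t i j) ∧ ∫ x, f x ∂twoPoint t i j = t * f i + (1 - t) * f j := by
  have h : ∀ c x : ℝ, Integrable f (ENNReal.ofReal c • Measure.dirac x) := fun c x =>
    (integrable_dirac (by simp)).smul_measure ENNReal.ofReal_ne_top
  refine ⟨(h t i).add_measure (h _ j), ?_⟩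
  rw [twoPoint, integral_add_measure (h _ _) (h _ _), integral_smul_measure,
    integral_smul_measure, integral_dirac, integral_dirac, ENNReal.toReal_ofReal ht,
    ENNReal.toReal_ofReal (sub_nonneg.2 ht1), smul_eq_mul, smul_eq_mul]

lemma isMixedStrategy_twoPoint (ht : 0 ≤ t) (ht1 : t ≤ 1) (hi : 0 ≤ i) (hj : 0 ≤ j) {c : ℝ}
    (hc : t * i + (1 - t) * j = c) : IsMixedStrategy c (twoPoint t i j) := by
  obtain ⟨h1, h2⟩ := integral_twoPoint (i := i) (j := j) ht ht1 fun x => x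
  refine ⟨⟨?_⟩, ?_, h1, (h2.trans hc).le⟩
  · simp only [twoPoint, Measure.add_apply, Measure.smul_apply, measure_univ, smul_eq_mul,
      mul_one]
    rw [← ENNReal.ofReal_add ht (sub_nonneg.2 ht1), add_sub_cancel, ENNReal.ofReal_one]
  · rw [twoPoint, ae_add_measure_iff]
    refine ⟨Measure.ae_smul_measure ?_ _, Measure.ae_smul_measure ?_ _⟩
    · rwa [ae_dirac_iff measurableSet_Ici]
    · rwa [ae_dirac_iff measurableSet_Ici]

end TwoPoint

/-- The truncated mean of a mixed strategy; it is maximal only for strategies that stay below the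
truncation. -/
lemma IsMixedStrategy.integral_min_div_le {c t : ℝ} {μ : Measure ℝ} (hμ : IsMixedStrategy c μ)
    (ht : 0 < t) :
    Integrable (fun x => min (x / t) 1) μ ∧ ∫ x, min (x / t) 1 ∂μ ≤ c / t ∧
      (c / t ≤ ∫ x, min (x / t) 1 ∂μ → ∀ᵐ x ∂μ, x ≤ t) := by
  have := hμ.isProb
  have h1 : Integrable (fun x : ℝ => x / t) μ := hμ.integrable.div_const t
  have h2 : Integrable (fun x => min (x / t) 1) μ := h1.inf (integrable_const 1)
  have h3 : ∫ x, x / t ∂μ ≤ c / t := by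
    rw [integral_div]
    exact div_le_div_of_nonneg_right hμ.mean_le ht.le
  refine ⟨h2, (integral_mono h2 h1 fun x => min_le_left _ _).trans h3, fun h => ?_⟩
  have h4 : ∫ x, (x / t - min (x / t) 1) ∂μ = 0 := by
    refine le_antisymm ?_ (integral_nonneg fun x => sub_nonneg.2 (min_le_left _ _))
    rw [integral_sub h1 h2]
    linarith
  rw [integral_eq_zero_iff_of_nonneg (fun x => sub_nonneg.2 (min_le_left _ _)) (h1.sub h2)] at h4
  filter_upwards [h4] with x hx
  have hx' : x / t - min (x / t) 1 = 0 := hx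
  have : x / t ≤ 1 := by
    have := min_le_right (x / t) 1
    linarith
  rwa [div_le_one ht] at this

/-- A function below a line whose integral reaches that of the line equals the line almost
everywhere. -/
lemma ae_eq_of_le_line {f : ℝ → ℝ} {α β : ℝ} {μ : Measure ℝ} [IsProbabilityMeasure μ]
    (hf : Integrable f μ) (hid : Integrable (fun x : ℝ => x) μ)
    (hle : ∀ᵐ x ∂μ, f x ≤ α + β * x) (hint : α + β * ∫ x, x ∂μ ≤ ∫ x, f x ∂μ) :
    ∀ᵐ x ∂μ, f x = α + β * x := by
  have hl : Integrable (fun x => α + β * x) μ := (integrable_const α).add (hid.const_mul β)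
  have h0 : ∫ x, (α + β * x) ∂μ = α + β * ∫ x, x ∂μ := by
    rw [integral_add (integrable_const α) (hid.const_mul β), integral_const_mul]
    simp
  have hnn : 0 ≤ᵐ[μ] fun x => (α + β * x) - f x := by
    filter_upwards [hle] with x hx using sub_nonneg.2 hx
  have h1 : ∫ x, ((α + β * x) - f x) ∂μ = 0 := by
    refine le_antisymm ?_ (integral_nonneg_of_ae hnn)
    rw [integral_sub hl hf]
    linarith
  rw [integral_eq_zero_iff_of_nonneg_ae hnn (hl.sub hf)] at h1
  filter_upwards [h1] with x hx
  exact (sub_eq_zero.1 hx).symm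

/-! ### Outage events and their slices -/

/-- The outage events up to ties: outage if `P < g J`, and only if `P ≤ g J`. -/
structure IsOutageSet (g : ℝ → ℝ) (E : Set (ℝ × ℝ)) : Prop where
  measurableSet : MeasurableSet E
  mem_of_lt : ∀ p j, 0 ≤ j → p < g j → (p, j) ∈ E
  le_of_mem : ∀ p j, 0 ≤ j → (p, j) ∈ E → p ≤ g j

/-- The probability of the event `E` for independent powers. -/
def payoff (E : Set (ℝ × ℝ)) (μ ν : Measure ℝ) : ℝ := (μ.prod ν).real E

section Payoff

variable {E : Set (ℝ × ℝ)} {μ ν : Measure ℝ} [IsProbabilityMeasure μ] [IsProbabilityMeasure ν]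

lemma payoff_eq_integral_right (hE : MeasurableSet E) :
    Integrable (fun j => μ.real {p | (p, j) ∈ E}) ν ∧
      payoff E μ ν = ∫ j, μ.real {p | (p, j) ∈ E} ∂ν := by
  have hm : Measurable fun j => μ {p | (p, j) ∈ E} := measurable_measure_prodMk_right hE
  refine ⟨Integrable.of_bound hm.ennreal_toReal.aestronglyMeasurable 1
    (Filter.Eventually.of_forall fun j => ?_), ?_⟩
  · rw [Real.norm_eq_abs, abs_of_nonneg measureReal_nonneg]
    exact measureReal_le_one
  · rw [payoff, measureReal_def, Measure.prod_apply_symm hE]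
    exact (integral_toReal hm.aemeasurable
      (Filter.Eventually.of_forall fun j => measure_lt_top _ _)).symm

lemma payoff_eq_integral_left (hE : MeasurableSet E) :
    Integrable (fun p => ν.real {j | (p, j) ∈ E}) μ ∧
      payoff E μ ν = ∫ p, ν.real {j | (p, j) ∈ E} ∂μ := by
  have hm : Measurable fun p => ν {j | (p, j) ∈ E} := measurable_measure_prodMk_left hE
  refine ⟨Integrable.of_bound hm.ennreal_toReal.aestronglyMeasurable 1
    (Filter.Eventually.of_forall fun j => ?_), ?_⟩
  · rw [Real.norm_eq_abs, abs_of_nonneg measureReal_nonneg]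
    exact measureReal_le_one
  · rw [payoff, measureReal_def, Measure.prod_apply hE]
    exact (integral_toReal hm.aemeasurable
      (Filter.Eventually.of_forall fun j => measure_lt_top _ _)).symm

end Payoff

section Slices

variable {g q : ℝ → ℝ} {E : Set (ℝ × ℝ)} {μ ν : Measure ℝ} [IsProbabilityMeasure μ]
  [IsProbabilityMeasure ν]

lemma IsOutageSet.slice_le (hE : IsOutageSet g E) {j : ℝ} (hj : 0 ≤ j) :
    μ.real {p | (p, j) ∈ E} ≤ μ.real (Set.Iic (g j)) :=
  measureReal_mono fun p hp => hE.le_of_mem p j hj hp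

lemma IsOutageSet.le_slice (hE : IsOutageSet g E) {j : ℝ} (hj : 0 ≤ j) :
    μ.real (Set.Iio (g j)) ≤ μ.real {p | (p, j) ∈ E} :=
  measureReal_mono fun p hp => hE.mem_of_lt p j hj hp

lemma IsOutageSet.slice_right_le (hE : IsOutageSet g E) (hν : ∀ᵐ j ∂ν, 0 ≤ j) (p : ℝ) :
    ν.real {j | (p, j) ∈ E} ≤ ν.real {j | p ≤ g j} := by
  refine ENNReal.toReal_mono (measure_ne_top _ _) (measure_mono_ae ?_)
  filter_upwards [hν] with j hj h using hE.le_of_mem p j hj h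

lemma IsOutageSet.le_slice_right (hE : IsOutageSet g E) (hν : ∀ᵐ j ∂ν, 0 ≤ j) (p : ℝ) :
    ν.real {j | p < g j} ≤ ν.real {j | (p, j) ∈ E} := by
  refine ENNReal.toReal_mono (measure_ne_top _ _) (measure_mono_ae ?_)
  filter_upwards [hν] with j hj h using hE.mem_of_lt p j hj h

end Slices

/-! ### The value of the game -/

section Value

variable {g q : ℝ → ℝ} {E : Set (ℝ × ℝ)} {a b w kp kj : ℝ}

/-- The transmitter's strategy limits the outage probability to the value of the game; only
jammers with power at most `w` reach it. -/
lemma payoff_txLaw_le (H : IsCurvePair g q) (hE : IsOutageSet g E) (hw : 0 < w) (hk : 0 < kp)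
    (hk1 : kp ≤ 1) {ν : Measure ℝ} (hν : IsMixedStrategy b ν) :
    payoff E (mixLaw kp w g) ν ≤ (1 - kp) + kp * (b / w) ∧
      ((1 - kp) + kp * (b / w) ≤ payoff E (mixLaw kp w g) ν → ∀ᵐ j ∂ν, j ≤ w) := by
  have := hν.isProb
  have := isProbabilityMeasure_mixLaw hk.le hk1 hw H.measurable
  obtain ⟨h1, h2, h3⟩ := hν.integral_min_div_le hw
  obtain ⟨h4, h5⟩ := payoff_eq_integral_right (μ := mixLaw kp w g) (ν := ν) hE.measurableSet
  have hi : Integrable (fun j => (1 - kp) + kp * min (j / w) 1) ν :=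
    (integrable_const _).add (h1.const_mul kp)
  have h6 : ∫ j, ((1 - kp) + kp * min (j / w) 1) ∂ν = (1 - kp) + kp * ∫ j, min (j / w) 1 ∂ν := by
    rw [integral_add (integrable_const _) (h1.const_mul kp), integral_const_mul]
    simp
  have h7 : payoff E (mixLaw kp w g) ν ≤ (1 - kp) + kp * ∫ j, min (j / w) 1 ∂ν := by
    rw [h5, ← h6]
    refine integral_mono_ae h4 hi ?_
    filter_upwards [hν.nonneg] with j hj
    refine (hE.slice_le hj).trans (le_of_eq ?_)
    rw [txLaw_real_Iic H hw hk.le hk1 hj, unif_real_Iic hw hj]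
    ring
  refine ⟨h7.trans (by gcongr), fun h => h3 ?_⟩
  exact le_of_mul_le_mul_left (by linarith) hk

/-- The jammer's strategy secures the value of the game; only transmitters with power at most `t`
reach it. -/
lemma le_payoff_jxLaw (H : IsCurvePair g q) (hE : IsOutageSet g E) {t : ℝ} (ht : 0 < t)
    (hk : 0 < kj) (hk1 : kj ≤ 1) {μ : Measure ℝ} (hμ : IsMixedStrategy a μ) :
    kj * (1 - a / t) ≤ payoff E μ (mixLaw kj t q) ∧
      (payoff E μ (mixLaw kj t q) ≤ kj * (1 - a / t) → ∀ᵐ p ∂μ, p ≤ t) := by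
  have := hμ.isProb
  have := isProbabilityMeasure_mixLaw hk.le hk1 ht H.measurable_q
  obtain ⟨h1, h2, h3⟩ := hμ.integral_min_div_le ht
  obtain ⟨h4, h5⟩ := payoff_eq_integral_left (μ := μ) (ν := mixLaw kj t q) hE.measurableSet
  have hi : Integrable (fun p => kj * (1 - min (p / t) 1)) μ :=
    ((integrable_const _).sub h1).const_mul kj
  have h6 : ∫ p, kj * (1 - min (p / t) 1) ∂μ = kj * (1 - ∫ p, min (p / t) 1 ∂μ) := by
    rw [integral_const_mul, integral_sub (integrable_const _) h1]
    simp
  have h7 : kj * (1 - ∫ p, min (p / t) 1 ∂μ) ≤ payoff E μ (mixLaw kj t q) := by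
    rw [h5, ← h6]
    refine integral_mono_ae hi h4 ?_
    filter_upwards [hμ.nonneg] with p hp
    refine le_trans ?_ (hE.le_slice_right
      (ae_mixLaw_of ht H.measurable_q measurableSet_Ici le_rfl fun x _ => H.q_nonneg x) p)
    have hm : MeasurableSet {j | p < g j} := measurableSet_lt measurable_const H.measurable
    have := isProbabilityMeasure_unif ht
    rw [mixLaw_real_apply hk.le hk1 ht H.measurable_q hm, ← unif_real_Ioi ht hp]
    -- Only an inclusion, because `q` collapses `[0, g 0]` to `0`; the contribution of the atom is
    -- dropped as well. At `p = 0` the loss is harmless in equilibrium: a transmitter with an atom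
    -- there faces `kj = 1`.
    have h8 : (unif t).real (Set.Ioi p) ≤ (unif t).real (q ⁻¹' {j | p < g j}) :=
      measureReal_mono fun x hx => lt_of_lt_of_le hx (H.le_g_q x)
    have h9 : 0 ≤ (1 - kj) * (Measure.dirac (0 : ℝ)).real {j | p < g j} :=
      mul_nonneg (sub_nonneg.2 hk1) measureReal_nonneg
    have h10 := mul_le_mul_of_nonneg_left h8 hk.le
    linarith
  refine ⟨le_trans (by gcongr) h7, fun h => h3 ?_⟩
  have := le_of_mul_le_mul_left (h7.trans h) hk
  linarith

end Value

/-! ### Uniqueness of the optimal strategies -/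

section

open Filter Topology

lemma frequently_nhdsGT_of_exists {p : ℝ → Prop} {w y : ℝ}
    (h : ∀ x z, 0 ≤ x → x < z → z ≤ w → ∃ j ∈ Set.Ioo x z, p j) (hy : 0 ≤ y) (hyw : y < w) :
    ∃ᶠ j in 𝓝[>] y, p j := by
  rw [(nhdsGT_basis y).frequently_iff]
  intro z hz
  obtain ⟨j, hj, hpj⟩ := h y (min z w) hy (lt_min hz hyw) (min_le_right _ _)
  exact ⟨j, ⟨hj.1, hj.2.trans_le (min_le_left _ _)⟩, hpj⟩

lemma frequently_nhdsLT_of_exists {p : ℝ → Prop} {w y : ℝ}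
    (h : ∀ x z, 0 ≤ x → x < z → z ≤ w → ∃ j ∈ Set.Ioo x z, p j) (hy : 0 < y) (hyw : y ≤ w) :
    ∃ᶠ j in 𝓝[<] y, p j := by
  rw [(nhdsLT_basis y).frequently_iff]
  intro z hz
  obtain ⟨j, hj, hpj⟩ := h (max z 0) y (le_max_right _ _) (max_lt hz hy) hyw
  exact ⟨j, ⟨(le_max_left _ _).trans_lt hj.1, hj.2⟩, hpj⟩

section

variable {g q : ℝ → ℝ} {E : Set (ℝ × ℝ)} {a b w kp kj V : ℝ}

lemma IsCurvePair.tendsto_nhdsGT (H : IsCurvePair g q) {y : ℝ} (hy : 0 ≤ y) :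
    Tendsto g (𝓝[>] y) (𝓝 (g y)) :=
  (H.continuousOn y hy).mono_left (nhdsWithin_mono y fun _ hx => hy.trans (le_of_lt hx))

lemma IsCurvePair.tendsto_nhdsLT (H : IsCurvePair g q) {y : ℝ} (hy : 0 < y) :
    Tendsto g (𝓝[<] y) (𝓝 (g y)) :=
  ((H.continuousOn y hy.le).continuousAt (Ici_mem_nhds hy)).mono_left nhdsWithin_le_nhds

lemma tendsto_measureReal_Iic (μ : Measure ℝ) [IsProbabilityMeasure μ] (x : ℝ) :
    Tendsto (fun y => μ.real (Set.Iic y)) (𝓝[≥] x) (𝓝 (μ.real (Set.Iic x))) := by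
  have h := (cdf μ).right_continuous x
  simp only [ContinuousWithinAt, cdf_eq_real] at h
  exact h.congr fun y => cdf_eq_real μ y

lemma measureReal_eq_zero_of_ae {μ : Measure ℝ} {p : ℝ → Prop} {s : Set ℝ} (hp : ∀ᵐ x ∂μ, p x)
    (hs : ∀ x ∈ s, ¬ p x) : μ.real s = 0 := by
  have h : μ s = 0 := measure_mono_null (fun x hx => hs x hx) hp
  rw [measureReal_def, h, ENNReal.toReal_zero]

lemma measureReal_Iic_eq_one_sub (μ : Measure ℝ) [IsProbabilityMeasure μ] (x : ℝ) :
    μ.real (Set.Iic x) = 1 - μ.real (Set.Ioi x) := by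
  rw [← Set.compl_Iic, probReal_compl_eq_one_sub measurableSet_Iic, sub_sub_cancel]

lemma ext_of_real_Iic {μ μ' : Measure ℝ} [IsProbabilityMeasure μ] [IsProbabilityMeasure μ']
    (h : ∀ x, μ.real (Set.Iic x) = μ'.real (Set.Iic x)) : μ = μ' :=
  Measure.ext_of_Iic _ _ fun x => (measureReal_eq_measureReal_iff).1 (h x)

/-- A distribution whose distribution function agrees from `c > 0` on with that of one without
mass in `(-∞, 0) ∪ (0, c]`, and whose mean is not larger, equals it. -/
lemma eq_of_real_Iic_eq_of_integral_le {μ μ' : Measure ℝ} [IsProbabilityMeasure μ]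
    [IsProbabilityMeasure μ'] {c : ℝ} (hc : 0 ≤ c)
    (hIic : ∀ x, c ≤ x → μ.real (Set.Iic x) = μ'.real (Set.Iic x)) (hμ : ∀ᵐ x ∂μ, 0 ≤ x)
    (hi : Integrable (fun x : ℝ => x) μ)
    (hle : ∫ x, x ∂μ ≤ ∫ x, x ∂μ') (hμ' : ∀ᵐ x ∂μ', x = 0 ∨ c < x) : μ = μ' := by
  -- Both laws have the same image under `T`, which fixes `μ'` almost surely. As `T` only lowers
  -- nonnegative values, the mean inequality forces it to fix `μ` almost surely too.
  set T : ℝ → ℝ := fun x => if x ≤ c then 0 else x with hT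
  have hTm : Measurable T := Measurable.ite measurableSet_Iic measurable_const measurable_id
  have hT' : ∀ᵐ x ∂μ', T x = x := by
    filter_upwards [hμ'] with x hx
    rcases hx with rfl | hx
    · simp [hT]
    · simp [hT, hx.not_ge]
  have := Measure.isProbabilityMeasure_map (μ := μ) hTm.aemeasurable
  have := Measure.isProbabilityMeasure_map (μ := μ') hTm.aemeasurable
  have hmap : μ.map T = μ'.map T := by
    refine ext_of_real_Iic fun x => ?_
    rw [map_measureReal_apply hTm measurableSet_Iic, map_measureReal_apply hTm measurableSet_Iic]
    rcases lt_or_ge x 0 with hx | hx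
    · have : T ⁻¹' Set.Iic x = ∅ := by
        ext z
        simp only [hT, Set.mem_preimage, Set.mem_Iic, Set.mem_empty_iff_false, iff_false, not_le]
        split_ifs <;> linarith
      rw [this, measureReal_empty, measureReal_empty]
    · have : T ⁻¹' Set.Iic x = Set.Iic (max x c) := by
        ext z
        simp only [hT, Set.mem_preimage, Set.mem_Iic, le_max_iff]
        split_ifs with hz
        · simp [hz, hx]
        · simp [hz]
      rw [this, hIic _ (le_max_right _ _)]
  have hmap' : μ'.map T = μ' := by
    rw [Measure.map_congr hT', Measure.map_id']
  have hiT : Integrable T μ := by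
    refine hi.mono hTm.aestronglyMeasurable (Eventually.of_forall fun x => ?_)
    simp only [hT]
    split_ifs <;> simp
  have hTle : ∀ᵐ x ∂μ, 0 ≤ x - T x := by
    filter_upwards [hμ] with x hx
    simp only [hT]
    split_ifs <;> simp [hx]
  have hint : ∫ x, (x - T x) ∂μ = 0 := by
    refine le_antisymm ?_ (integral_nonneg_of_ae hTle)
    rw [integral_sub hi hiT]
    have h1 : ∫ x, T x ∂μ = ∫ x, x ∂μ' := by
      have := integral_map (μ := μ) hTm.aemeasurable (f := fun x : ℝ => x) (by fun_prop)
      rw [← this, hmap, hmap']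
    linarith
  rw [integral_eq_zero_iff_of_nonneg_ae hTle (hi.sub hiT)] at hint
  have hT2 : ∀ᵐ x ∂μ, T x = x := by
    filter_upwards [hint] with x hx using (sub_eq_zero.1 hx).symm
  rw [← hmap', ← hmap, Measure.map_congr hT2, Measure.map_id']

lemma exists_of_ae_txLaw (H : IsCurvePair g q) (hw : 0 < w) (hk : 0 < kp) {p : ℝ → Prop}
    (hp : ∀ᵐ x ∂mixLaw kp w g, p x) (x z : ℝ) (hx : 0 ≤ x) (hxz : x < z) (hz : z ≤ w) :
    ∃ j ∈ Set.Ioo x z, p (g j) :=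
  exists_mem_Ioo_of_ae_mixLaw hk hw H.measurable hp hx hxz hz

/-- The interval is pulled back to `(g x, g z)`, which avoids the flat part of `q` below `g 0`. -/
lemma exists_of_ae_jxLaw (H : IsCurvePair g q) (hw : 0 < w) (hk : 0 < kj) {p : ℝ → Prop}
    (hp : ∀ᵐ x ∂mixLaw kj (g w) q, p x) (x z : ℝ) (hx : 0 ≤ x) (hxz : x < z) (hz : z ≤ w) :
    ∃ j ∈ Set.Ioo x z, p j := by
  have hz0 : 0 ≤ z := hx.trans hxz.le
  obtain ⟨y, hy, hpy⟩ := exists_mem_Ioo_of_ae_mixLaw hk (H.pos_of_nonneg hw.le) H.measurable_q hp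
    (H.pos_of_nonneg hx).le ((H.lt_iff hx hz0).2 hxz) (H.monotone hz)
  have hy0 : g 0 ≤ y := (H.monotone hx).trans hy.1.le
  refine ⟨q y, ⟨?_, ?_⟩, hpy⟩
  · rw [← H.lt_iff hx (H.q_nonneg y), H.g_q hy0]; exact hy.1
  · rw [← H.lt_iff (H.q_nonneg y) hz0, H.g_q hy0]; exact hy.2

/-- The transmitter's optimal strategy is unique. -/
lemma eq_txLaw_of_optimal (H : IsCurvePair g q) (hE : IsOutageSet g E) (hb : 0 < b)
    (P : IsEquilibriumParam g a b w kp kj) {μ : Measure ℝ} (hμ : IsMixedStrategy a μ)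
    (hV : V = (1 - kp) + kp * (b / w))
    (hopt : ∀ ν, IsMixedStrategy b ν → payoff E μ ν ≤ V) : μ = mixLaw kp w g := by
  have hw : 0 < w := hb.trans P.b_lt
  have hgw := H.pos_of_nonneg hw.le
  have := hμ.isProb
  have hν := isMixedStrategy_jxLaw H hb P
  have hμs := isMixedStrategy_txLaw H hb P
  have := hν.isProb
  have := hμs.isProb
  set φ : ℝ → ℝ := fun j => μ.real {p | (p, j) ∈ E} with hφ
  set F : ℝ → ℝ := fun j => μ.real (Set.Iic (g j)) with hF
  -- Ties are handled by a sandwich: `φ j` lies between `F j` and every `F i` with `i < j`,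
  -- whichever convention `E` follows.
  have hφF : ∀ j, 0 ≤ j → φ j ≤ F j := fun j hj => hE.slice_le hj
  have hFφ : ∀ i j, 0 ≤ i → i < j → F i ≤ φ j := fun i j hi hij =>
    le_trans (measureReal_mono fun p hp =>
      lt_of_le_of_lt hp ((H.lt_iff hi (hi.trans hij.le)).2 hij)) (hE.le_slice (hi.trans hij.le))
  obtain ⟨α, β, hαβ, hline⟩ := exists_supporting_line (φ := φ) (V := V) hb
    fun i j t hi hj ht ht1 hm => by
      have hs := isMixedStrategy_twoPoint ht ht1 hi hj hm
      have := hs.isProb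
      rw [← (integral_twoPoint ht ht1 φ).2,
        ← (payoff_eq_integral_right (μ := μ) hE.measurableSet).2]
      exact hopt _ hs
  have hlineT : ∀ y : ℝ, Tendsto (fun j => α + β * j) (𝓝 y) (𝓝 (α + β * y)) := fun y =>
    (by fun_prop : Continuous fun j => α + β * j).tendsto y
  have hsupp : ∀ᵐ p ∂μ, p ≤ g w := by
    refine (le_payoff_jxLaw H hE hgw P.kj_pos P.kj_le hμ).2 ?_
    rw [← P.value_eq H hb, ← hV]
    exact hopt _ hν
  have hae : ∀ᵐ j ∂mixLaw kj (g w) q, φ j = α + β * j := by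
    obtain ⟨h1, h2⟩ := payoff_eq_integral_right (μ := μ) (ν := mixLaw kj (g w) q) hE.measurableSet
    refine ae_eq_of_le_line h1 hν.integrable ?_ ?_
    · filter_upwards [hν.nonneg] with j hj using hline j hj
    · rw [integral_jxLaw H hb P, hαβ, ← h2, hV, P.value_eq H hb]
      exact (le_payoff_jxLaw H hE hgw P.kj_pos P.kj_le hμ).1
  have hex := exists_of_ae_jxLaw H hw P.kj_pos hae
  -- Equality with the line holds at points arbitrarily close to `y` on either side; limits from the
  -- right bound `F y` above, limits from the left bound it below.
  have hupper : ∀ y, 0 ≤ y → y < w → F y ≤ α + β * y := fun y hy hyw =>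
    ge_of_tendsto_of_frequently ((hlineT y).mono_left nhdsWithin_le_nhds)
      (((frequently_nhdsGT_of_exists hex hy hyw).and_eventually self_mem_nhdsWithin).mono
        fun j hj => hj.1 ▸ hFφ y j hy hj.2)
  have hlower : ∀ y, 0 < y → y ≤ w → α + β * y ≤ F y := fun y hy hyw =>
    le_of_tendsto_of_frequently ((hlineT y).mono_left nhdsWithin_le_nhds)
      (((frequently_nhdsLT_of_exists hex hy hyw).and_eventually
        (Ioo_mem_nhdsLT hy)).mono fun j hj =>
        hj.1 ▸ (hφF j hj.2.1.le).trans (measureReal_mono (Set.Iic_subset_Iic.2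
          (H.monotone hj.2.2.le))))
  have hF1 : ∀ y, w ≤ y → F y = 1 := fun y hy => by
    have h0 : μ.real (Set.Ioi (g y)) = 0 := measureReal_eq_zero_of_ae hsupp fun p hp =>
      not_le.2 ((H.monotone hy).trans_lt hp)
    exact (measureReal_Iic_eq_one_sub μ (g y)).trans (by rw [h0, sub_zero])
  have hw1 : α + β * w = 1 := by
    refine le_antisymm ((hlower w hw le_rfl).trans measureReal_le_one) ?_
    refine ge_of_tendsto ((hlineT w).mono_left (nhdsWithin_le_nhds (s := Set.Ioi w))) ?_
    filter_upwards [self_mem_nhdsWithin] with j hj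
    rw [← hF1 w le_rfl]
    exact (hFφ w j hw.le hj).trans (hline j (hw.le.trans (le_of_lt hj)))
  -- Two points determine the line: height `V` at `b` and height `1` at `w`.
  have hβ : β = kp / w := by
    have h1 : β * (w - b) = kp / w * (w - b) := by
      have : kp / w * (w - b) = kp - kp * (b / w) := by field_simp
      linarith
    exact mul_right_cancel₀ (sub_pos.2 P.b_lt).ne' h1
  have hα : α = 1 - kp := by
    rw [hβ, div_mul_cancel₀ _ hw.ne'] at hw1
    linarith
  -- There is no left neighbourhood at `0`; right continuity of the distribution function replaces
  -- it.
  have hF0 : α + β * 0 ≤ F 0 := by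
    have h1 : Tendsto F (𝓝[>] 0) (𝓝 (F 0)) := by
      refine (tendsto_measureReal_Iic μ (g 0)).comp (tendsto_nhdsWithin_iff.2
        ⟨H.tendsto_nhdsGT le_rfl, ?_⟩)
      filter_upwards [self_mem_nhdsWithin] with j hj using H.monotone (le_of_lt hj)
    refine le_of_tendsto_of_tendsto ((hlineT 0).mono_left nhdsWithin_le_nhds) h1 ?_
    filter_upwards [Ioo_mem_nhdsGT hw] with j hj using hlower j hj.1 hj.2.le
  have hFeq : ∀ y, 0 ≤ y → F y = (mixLaw kp w g).real (Set.Iic (g y)) := by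
    intro y hy
    rw [txLaw_real_Iic H hw P.kp_pos.le P.kp_le hy, unif_real_Iic hw hy]
    rcases lt_or_ge y w with hyw | hyw
    · have h1 : F y = α + β * y := by
        refine le_antisymm (hupper y hy hyw) ?_
        rcases hy.eq_or_lt with rfl | hy
        · exact hF0
        · exact hlower y hy hyw.le
      rw [h1, hα, hβ, min_eq_left ((div_le_one hw).2 hyw.le)]
      ring
    · rw [hF1 y hyw, min_eq_right ((one_le_div hw).2 hyw)]
      ring
  refine eq_of_real_Iic_eq_of_integral_le H.pos.le (fun x hx => ?_) hμ.nonneg hμ.integrable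
    (hμ.mean_le.trans (integral_txLaw H hb P).ge) ?_
  · obtain ⟨y, hy, rfl⟩ := H.exists_eq hx
    exact hFeq y hy
  · exact ae_mixLaw_of hw H.measurable ((measurableSet_singleton 0).union measurableSet_Ioi)
      (.inl rfl) fun x hx => .inr ((H.lt_iff le_rfl hx.1.le).2 hx.1)

/-- The jammer's optimal strategy is unique. -/
lemma eq_jxLaw_of_optimal (H : IsCurvePair g q) (hE : IsOutageSet g E) (ha : 0 < a) (hb : 0 < b)
    (P : IsEquilibriumParam g a b w kp kj) {ν : Measure ℝ} (hν : IsMixedStrategy b ν)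
    (hV : V = (1 - kp) + kp * (b / w))
    (hopt : ∀ μ, IsMixedStrategy a μ → V ≤ payoff E μ ν) : ν = mixLaw kj (g w) q := by
  have hw : 0 < w := hb.trans P.b_lt
  have hgw := H.pos_of_nonneg hw.le
  have := hν.isProb
  have hνs := isMixedStrategy_jxLaw H hb P
  have hμs := isMixedStrategy_txLaw H hb P
  have := hνs.isProb
  have := hμs.isProb
  set ψ : ℝ → ℝ := fun p => ν.real {j | (p, j) ∈ E} with hψ
  set N : ℝ → ℝ := fun y => ν.real (Set.Ioi y) with hN
  have hN_anti : ∀ x y, x ≤ y → N y ≤ N x := fun x y hxy =>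
    measureReal_mono (Set.Ioi_subset_Ioi hxy)
  have hψN : ∀ i j, 0 ≤ i → i < j → ψ (g j) ≤ N i := fun i j hi hij => by
    refine (hE.slice_right_le hν.nonneg (g j)).trans (measureReal_mono fun k hk => ?_)
    by_contra hki
    rw [Set.mem_Ioi, not_lt] at hki
    exact (H.monotone hki).not_gt (((H.lt_iff hi (hi.trans hij.le)).2 hij).trans_le hk)
  have hNψ : ∀ j, 0 ≤ j → N j ≤ ψ (g j) := fun j hj =>
    le_trans (measureReal_mono fun k hk => (H.lt_iff hj (hj.trans (le_of_lt hk))).2 hk)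
      (hE.le_slice_right hν.nonneg (g j))
  -- The transmitter minimizes, so the supporting line is taken for `-ψ`, now as a function of `p`;
  -- along the curve it becomes affine in `g y`.
  obtain ⟨α', β', hαβ', hline'⟩ := exists_supporting_line (φ := fun p => -ψ p) (V := -V) ha
    fun i j t hi hj ht ht1 hm => by
      have hs := isMixedStrategy_twoPoint ht ht1 hi hj hm
      have := hs.isProb
      have h1 := hopt _ hs
      rw [(payoff_eq_integral_left (ν := ν) hE.measurableSet).2,
        (integral_twoPoint ht ht1 ψ).2] at h1
      linarith
  have hlineT : ∀ y : ℝ, Tendsto (fun p => α' + β' * p) (𝓝 y) (𝓝 (α' + β' * y)) := fun y =>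
    (by fun_prop : Continuous fun j => α' + β' * j).tendsto y
  have hsupp : ∀ᵐ j ∂ν, j ≤ w := by
    refine (payoff_txLaw_le H hE hw P.kp_pos P.kp_le hν).2 ?_
    rw [← hV]
    exact hopt _ hμs
  have hae : ∀ᵐ p ∂mixLaw kp w g, -ψ p = α' + β' * p := by
    obtain ⟨h1, h2⟩ := payoff_eq_integral_left (μ := mixLaw kp w g) (ν := ν) hE.measurableSet
    refine ae_eq_of_le_line h1.neg hμs.integrable ?_ ?_
    · filter_upwards [hμs.nonneg] with p hp using hline' p hp
    · have h3 : ∫ p, -ψ p ∂mixLaw kp w g = -payoff E (mixLaw kp w g) ν := by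
        rw [h2, integral_neg]
      rw [integral_txLaw H hb P, hαβ', h3, neg_le_neg_iff, hV]
      exact (payoff_txLaw_le H hE hw P.kp_pos P.kp_le hν).1
  have hex := exists_of_ae_txLaw H hw P.kp_pos hae
  have hupper : ∀ y, 0 ≤ y → y < w → α' + β' * g y ≥ -N y := fun y hy hyw =>
    ge_of_tendsto_of_frequently ((hlineT (g y)).comp (H.tendsto_nhdsGT hy))
      (((frequently_nhdsGT_of_exists hex hy hyw).and_eventually self_mem_nhdsWithin).mono
        fun j hj => (neg_le_neg (hψN y j hy hj.2)).trans_eq hj.1)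
  have hlower : ∀ y, 0 < y → y ≤ w → α' + β' * g y ≤ -N y := fun y hy hyw =>
    le_of_tendsto_of_frequently ((hlineT (g y)).comp (H.tendsto_nhdsLT hy))
      (((frequently_nhdsLT_of_exists hex hy hyw).and_eventually
        (Ioo_mem_nhdsLT hy)).mono fun j hj =>
        hj.1.symm.trans_le (neg_le_neg ((hN_anti j y hj.2.2.le).trans (hNψ j hj.2.1.le))))
  have hNw : N w = 0 := measureReal_eq_zero_of_ae hsupp fun j hj => not_le.2 hj
  have hw0 : α' + β' * g w = 0 := by
    refine le_antisymm ((hlower w hw le_rfl).trans (by rw [hNw, neg_zero])) ?_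
    refine ge_of_tendsto ((hlineT (g w)).comp (H.tendsto_nhdsGT hw.le)) ?_
    filter_upwards [self_mem_nhdsWithin] with j hj
    have h1 := hψN w j hw.le hj
    have h2 := hline' (g j) (H.pos_of_nonneg (hw.le.trans (le_of_lt hj))).le
    simp only [Function.comp]
    linarith
  have hV' : V = kj * (1 - a / g w) := by rw [hV, P.value_eq H hb]
  have hβ : β' = kj / g w := by
    have h1 : β' * (g w - a) = kj / g w * (g w - a) := by
      have : kj / g w * (g w - a) = kj * (1 - a / g w) := by field_simp
      linarith
    exact mul_right_cancel₀ (sub_pos.2 P.a_lt).ne' h1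
  have hα : α' = -kj := by
    rw [hβ, div_mul_cancel₀ _ hgw.ne'] at hw0
    linarith
  have hNI : ∀ y, ν.real (Set.Iic y) = 1 - N y := measureReal_Iic_eq_one_sub ν
  have hN0 : α' + β' * g 0 ≤ -N 0 := by
    have h1 : Tendsto (fun y => -N y) (𝓝[>] 0) (𝓝 (-N 0)) := by
      have := ((tendsto_measureReal_Iic ν 0).mono_left
        (nhdsWithin_mono 0 Set.Ioi_subset_Ici_self)).sub_const 1
      simpa only [hNI, sub_sub_cancel_left] using this
    refine le_of_tendsto_of_tendsto ((hlineT (g 0)).comp (H.tendsto_nhdsGT le_rfl)) h1 ?_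
    filter_upwards [Ioo_mem_nhdsGT hw] with j hj using hlower j hj.1 hj.2.le
  -- No mean argument is needed here: `y` itself is the jammer's power, so the distribution function
  -- is determined on all of `[0, ∞)`.
  refine ext_of_real_Iic fun y => ?_
  rcases lt_or_ge y 0 with hy | hy
  · have h1 : ∀ ρ : Measure ℝ, (∀ᵐ x ∂ρ, 0 ≤ x) → ρ.real (Set.Iic y) = 0 := fun ρ hρ =>
      measureReal_eq_zero_of_ae hρ fun x hx => not_le.2 (lt_of_le_of_lt hx hy)
    rw [h1 ν hν.nonneg, h1 _ hνs.nonneg]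
  rw [jxLaw_real_Iic H hgw P.kj_pos.le P.kj_le hy, unif_real_Iic hgw (H.pos_of_nonneg hy).le, hNI]
  rcases lt_or_ge y w with hyw | hyw
  · have h1 : α' + β' * g y = -N y := by
      refine le_antisymm ?_ (hupper y hy hyw)
      rcases hy.eq_or_lt with rfl | hy
      · exact hN0
      · exact hlower y hy hyw.le
    rw [hα, hβ] at h1
    rw [min_eq_left ((div_le_one hgw).2 (H.monotone hyw.le))]
    linear_combination -h1
  · have h1 : N y = 0 := le_antisymm ((hN_anti w y hyw).trans hNw.le) measureReal_nonneg
    rw [h1, min_eq_right ((one_le_div hgw).2 (H.monotone hyw))]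
    ring

/-- The Nash equilibrium of the game, for either treatment of ties. -/
theorem isNash_payoff_iff (H : IsCurvePair g q) (hE : IsOutageSet g E) (ha : 0 < a) (hb : 0 < b)
    (P : IsEquilibriumParam g a b w kp kj) (μ ν : Measure ℝ) :
    IsNash (payoff E) a b μ ν ↔ μ = mixLaw kp w g ∧ ν = mixLaw kj (g w) q := by
  have hw : 0 < w := hb.trans P.b_lt
  have hgw := H.pos_of_nonneg hw.le
  have hμs := isMixedStrategy_txLaw H hb P
  have hνs := isMixedStrategy_jxLaw H hb P
  have hup : ∀ ν', IsMixedStrategy b ν' → payoff E (mixLaw kp w g) ν' ≤ (1 - kp) + kp * (b / w) :=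
    fun ν' h => (payoff_txLaw_le H hE hw P.kp_pos P.kp_le h).1
  have hlow : ∀ μ', IsMixedStrategy a μ' →
      (1 - kp) + kp * (b / w) ≤ payoff E μ' (mixLaw kj (g w) q) := fun μ' h => by
    rw [P.value_eq H hb]
    exact (le_payoff_jxLaw H hE hgw P.kj_pos P.kj_le h).1
  constructor
  · intro N
    -- Deviations to the candidate laws pin the payoff of any equilibrium to the value, so both of
    -- its components are optimal.
    have h1 := (N.min_left _ hμs).trans (hup ν N.right)
    have h2 := (hlow μ N.left).trans (N.max_right _ hνs)
    exact ⟨eq_txLaw_of_optimal H hE hb P N.left rfl fun ν' h => (N.max_right ν' h).trans h1,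
      eq_jxLaw_of_optimal H hE ha hb P N.right rfl fun μ' h => h2.trans (N.min_left μ' h)⟩
  · rintro ⟨rfl, rfl⟩
    exact ⟨hμs, hνs, fun μ' h => (hup _ hνs).trans (hlow μ' h),
      fun ν' h => (hup ν' h).trans (hlow _ hμs)⟩

end

end

/-! ### Transfer to the two outage probabilities -/

lemma IsNash.of_eqOn {K K' : Measure ℝ → Measure ℝ → ℝ} {a b : ℝ} {μ ν : Measure ℝ}
    (h : ∀ μ ν, IsMixedStrategy a μ → IsMixedStrategy b ν → K μ ν = K' μ ν)
    (N : IsNash K a b μ ν) : IsNash K' a b μ ν :=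
  ⟨N.left, N.right,
    fun μ' hμ' => by rw [← h μ ν N.left N.right, ← h μ' ν hμ' N.right]; exact N.min_left μ' hμ',
    fun ν' hν' => by rw [← h μ ν N.left N.right, ← h μ ν' N.left hν']; exact N.max_right ν' hν'⟩

/-- Rewriting `outageProb` as the probability of a complement needs probability measures, so payoffs
are compared on admissible strategies only. -/
lemma isNash_congr {K K' : Measure ℝ → Measure ℝ → ℝ} {a b : ℝ} {μ ν : Measure ℝ}
    (h : ∀ μ ν, IsMixedStrategy a μ → IsMixedStrategy b ν → K μ ν = K' μ ν) :
    IsNash K a b μ ν ↔ IsNash K' a b μ ν :=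
  ⟨fun N => N.of_eqOn h, fun N => N.of_eqOn fun μ ν hμ hν => (h μ ν hμ hν).symm⟩

section

variable {g q : ℝ → ℝ}

lemma IsCurvePair.isOutageSet_lt (H : IsCurvePair g q) :
    IsOutageSet g {z : ℝ × ℝ | g z.2 ≤ z.1}ᶜ where
  measurableSet := (measurableSet_le (H.measurable.comp measurable_snd) measurable_fst).compl
  mem_of_lt _ _ _ h := not_le.2 h
  le_of_mem p j _ h := (not_le.1 (show ¬ g j ≤ p from h)).le

lemma IsCurvePair.isOutageSet_le (H : IsCurvePair g q) :
    IsOutageSet g {z : ℝ × ℝ | q z.1 ≤ z.2} where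
  measurableSet := measurableSet_le (H.measurable_q.comp measurable_fst) measurable_snd
  mem_of_lt _ _ hj h := (H.q_le_iff hj).2 h.le
  le_of_mem _ _ hj h := (H.q_le_iff hj).1 h

variable {a b w kp kj : ℝ}

lemma cdf_txLaw (H : IsCurvePair g q) (hb : 0 < b) (P : IsEquilibriumParam g a b w kp kj) {y : ℝ}
    (hy : 0 ≤ y) : cdf (mixLaw kp w g) (g y) =
      kp * cdf (unif w) y + (1 - kp) * cdf (Measure.dirac 0) y := by
  have hw : 0 < w := hb.trans P.b_lt
  have := (isMixedStrategy_txLaw H hb P).isProb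
  have := isProbabilityMeasure_unif hw
  rw [cdf_eq_real, cdf_eq_real, cdf_eq_real, txLaw_real_Iic H hw P.kp_pos.le P.kp_le hy,
    dirac_zero_real_Iic hy, mul_one]

lemma cdf_jxLaw (H : IsCurvePair g q) (hb : 0 < b) (P : IsEquilibriumParam g a b w kp kj) {x : ℝ}
    (hx : g 0 ≤ x) : cdf (mixLaw kj (g w) q) (q x) =
      kj * cdf (unif (g w)) x + (1 - kj) * cdf (Measure.dirac 0) x := by
  have hgw := H.pos_of_nonneg (hb.trans P.b_lt).le
  have := (isMixedStrategy_jxLaw H hb P).isProb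
  have := isProbabilityMeasure_unif hgw
  rw [cdf_eq_real, cdf_eq_real, cdf_eq_real,
    jxLaw_real_Iic H hgw P.kj_pos.le P.kj_le (H.q_nonneg x), H.g_q hx,
    dirac_zero_real_Iic (H.pos.le.trans hx), mul_one]

end

end JammingGame

end

theorem mainTheorem8 {M : ℕ} (h : Fin M → ℝ) (hh : ∀ m, 0 ≤ h m) (hpos : ∃ m, 0 < h m)
    (σ2 R : ℝ) (hσ : 0 < σ2) (hR : 0 < R) (a b : ℝ) (ha : 0 < a) (hb : 0 < b)
    (g : ℝ → ℝ) (hg : g = JammingGame.txCurve h σ2 R)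
    (q : ℝ → ℝ) (hq : q = JammingGame.jxCurve h σ2 R) :
    ∃ v₀ v kp kj S : ℝ,
      -- step 1: `v₀` is the unique solution of its equation
      (∀ w : ℝ, (0 ≤ w ∧ a * b = (g (2 * w) - a) * (2 * w - b)) ↔ w = v₀) ∧
      -- step 2
      S = (∫ y in (0 : ℝ)..(2 * v₀), g y) - 2 * v₀ * a ∧
      -- ranges of the parameters
      kp ∈ Set.Icc (0 : ℝ) 1 ∧ kj ∈ Set.Icc (0 : ℝ) 1 ∧ max b (q a / 2) ≤ v ∧
      -- steps 3, 4, 5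
      (S < 0 →
        (∀ w : ℝ, (0 < w ∧ (∫ y in (0 : ℝ)..(2 * w), g y) - 2 * w * a = 0) ↔ w = v) ∧
        kp = 1 ∧ kj = b * g (2 * v) / (2 * v * (g (2 * v) - a))) ∧
      (S = 0 → v = v₀ ∧ kp = 1 ∧ kj = 1) ∧
      (0 < S →
        (∀ w : ℝ, (0 ≤ w ∧ (∫ y in (0 : ℝ)..(2 * w), g y) - g (2 * w) * (2 * w - b) = 0) ↔
          w = v) ∧
        kp = 2 * v * a / (g (2 * v) * (2 * v - b)) ∧ kj = 1) ∧
      -- the distribution functions along the required-power curves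
      (∀ y : ℝ, 0 ≤ y → ProbabilityTheory.cdf (JammingGame.mixLaw kp (2 * v) g) (g y) =
        kp * ProbabilityTheory.cdf (JammingGame.unif (2 * v)) y +
          (1 - kp) * ProbabilityTheory.cdf (MeasureTheory.Measure.dirac 0) y) ∧
      (∀ x : ℝ, g 0 ≤ x → ProbabilityTheory.cdf (JammingGame.mixLaw kj (g (2 * v)) q) (q x) =
        kj * ProbabilityTheory.cdf (JammingGame.unif (g (2 * v))) x +
          (1 - kj) * ProbabilityTheory.cdf (MeasureTheory.Measure.dirac 0) x) ∧
      -- existence, form and uniqueness of the Nash equilibrium, for both expressions of the outage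
      (∀ μ ν : MeasureTheory.Measure ℝ,
        JammingGame.IsNash (JammingGame.outageProb h σ2 R) a b μ ν ↔
          μ = JammingGame.mixLaw kp (2 * v) g ∧ ν = JammingGame.mixLaw kj (g (2 * v)) q) ∧
      (∀ μ ν : MeasureTheory.Measure ℝ,
        JammingGame.IsNash (JammingGame.outageProb' h σ2 R) a b μ ν ↔
          μ = JammingGame.mixLaw kp (2 * v) g ∧ ν = JammingGame.mixLaw kj (g (2 * v)) q) := by
  have H : JammingGame.IsCurvePair g q := by
    subst hg hq
    exact JammingGame.isCurvePair_txCurve_jxCurve hh hpos hσ hR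
  obtain ⟨w₀, w, kp, kj, S, hw₀, hS, P, hneg, hzero, hpos'⟩ := H.exists_equilibriumParam ha hb
  have hw : 0 < w := hb.trans P.b_lt
  have e : 2 * (w / 2) = w := by ring
  have e₀ : 2 * (w₀ / 2) = w₀ := by ring
  -- The parameters were found in terms of `w = 2 * v`; this translates the uniqueness statements.
  have half : ∀ {u x : ℝ}, u = x / 2 ↔ 2 * u = x := fun {u x} =>
    ⟨fun h => by linarith, fun h => by linarith⟩
  refine ⟨w₀ / 2, w / 2, kp, kj, S, fun u => ?_, ?_, ⟨P.kp_pos.le, P.kp_le⟩,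
    ⟨P.kj_pos.le, P.kj_le⟩, ?_, fun hlt => ⟨fun u => ?_, ?_⟩, fun h0 => ?_,
    fun hgt => ⟨fun u => ?_, ?_⟩, fun y hy => ?_, fun x hx => ?_, fun μ ν => ?_, fun μ ν => ?_⟩
  · rw [half, ← hw₀]
    simp
  · rw [e₀, hS]
  · have h1 := P.two_mul_le H hb
    have h2 := (H.q_le_iff hw.le).2 P.a_lt.le
    exact max_le (by linarith) (by linarith)
  · rw [half, ← (hneg hlt).1]
    simp
  · rw [e]
    exact (hneg hlt).2
  · obtain ⟨h1, h2⟩ := hzero h0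
    exact ⟨by rw [h1], h2⟩
  · rw [half, ← (hpos' hgt).1]
    simp
  · rw [e]
    exact (hpos' hgt).2
  · rw [e]
    exact JammingGame.cdf_txLaw H hb P hy
  · rw [e]
    exact JammingGame.cdf_jxLaw H hb P hx
  · rw [e, ← JammingGame.isNash_payoff_iff H H.isOutageSet_lt ha hb P]
    refine JammingGame.isNash_congr fun μ ν hμ hν => ?_
    have := hμ.isProb
    have := hν.isProb
    have hm := H.isOutageSet_lt.measurableSet.of_compl
    rw [JammingGame.payoff, JammingGame.outageProb, ← hg,
      MeasureTheory.probReal_compl_eq_one_sub hm]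
  · rw [e, ← JammingGame.isNash_payoff_iff H H.isOutageSet_le ha hb P]
    refine JammingGame.isNash_congr fun μ ν hμ hν => ?_
    rw [JammingGame.payoff, JammingGame.outageProb', ← hq]
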